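/- Let $G=(V,E)$ be a finite $2$-edge-connected multigraph and let $s\neq t$ be two of its vertices. For $A\subseteq V$ let $\delta_G(A)$ be the set of edges with exactly one end in $A$, let $\lambda_G(u,v)$ be the minimum of $|\delta_G(A)|$ over all $A$ with $u\in A$, $v\notin A$, and call $\delta_G(A)$ a $2$-$st$-cut if $s\in A$, $t\notin A$ and $|\delta_G(A)|=2$. The edges of the $2$-$st$-cuts are called forced. A set $H\subseteq E$ is a feasible solution of SD-3-RSND (the single relative demand $r(s,t)=3$) if for every $F\subseteq E$ with $|F|<3$: if $G\setminus F$ contains an $st$-path, then so does $H\setminus F$. A $3$-demand is a pair $uv$ of distinct vertices; it is ordinary if $\lambda_G(u,v)\ge 3$, and $H$ satisfies it if $u$ and $v$ are connected in $H\setminus F$ for every $F$ with $|F|<3$. **Theorem.** There is a set $D=D(G,s,t)$ of ordinary $3$-demands, computable from $(G,s,t)$ in time polynomial in $|V|+|E|$, such that for every $H\subseteq E$ that contains all forced edges, $H$ is a feasible solution of SD-3-RSND if and only if $H$ satisfies all demands in $D$. Moreover, suppose that $\lambda_G(s,t)<3$. The $3$-classes of $G$ are the classes of the equivalence relation "no cut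 $\delta_G(A)$ with exactly two edges separates $u$ and $v$", and the cactus of $G$ is obtained by shrinking every $3$-class to a node and dropping loops. Call a $3$-class $st$-relevant if it lies on a cycle of the cactus that contains a $2$-$st$-cut, and let the set $R_C$ of attachment nodes of a $3$-class $C$ consist of the vertices of $C$ that are $s$, or $t$, or an end of an edge lying on such a cycle. Then $D$ is the union of the cliques on the sets $R_C$ over all $st$-relevant $3$-classes $C$; and if each of these cliques is replaced by an arbitrary tree with vertex set $R_C$, then, again for every $H\subseteq E$ containing all forced edges, $H$ is feasible if and only if it satisfies all demands in the resulting set. -/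

import Mathlib

/-! ### Edge cuts and connectivity in multigraphs -/

namespace RSND

/-- There is a path from `u` to `v` in the multigraph `G`. -/
def Joined {V E : Type*} (G : Graph V E) (u v : V) : Prop :=
  Relation.ReflTransGen G.Adj u v

/-- `δ_G(A)`: the edges of `G` with exactly one end in `A`. -/
def cut {V E : Type*} (G : Graph V E) (A : Set V) : Set E :=
  {e | ∃ x ∈ A, ∃ y ∉ A, G.IsLink e x y}

/-- `λ_G(u,v)`: the minimum size of a cut `δ_G(A)` with `u ∈ A` and `v ∉ A`. -/
noncomputable def edgeConn {V E : Type*} (G : Graph V E) (u v : V) : ℕ∞ :=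
  ⨅ A ∈ {A : Set V | u ∈ A ∧ v ∉ A}, (cut G A).encard

/-- `u` and `v` remain connected in `G` whenever fewer than `k` edges fail. -/
def EdgeReachable {V E : Type*} (G : Graph V E) (k : ℕ) (u v : V) : Prop :=
  ∀ F : Set E, F.encard < k → Joined (G.deleteEdges F) u v

/-- `G` is `2`-edge-connected. -/
def TwoEdgeConnected {V E : Type*} (G : Graph V E) : Prop :=
  ∀ u ∈ G.vertexSet, ∀ v ∈ G.vertexSet, EdgeReachable G 2 u v

/-! ### The problem with the single demand `r(s,t) = 3`

A solution is a set `H` of edges, identified with the spanning subgraph `G.restrict H`. -/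

/-- `H` is a feasible solution for the relative demand `r(s,t) = 3`: for every set `F` of fewer
than three edges, if `G \ F` has an `st`-path, then so has `H \ F`. -/
def Feasible {V E : Type*} (G : Graph V E) (s t : V) (H : Set E) : Prop :=
  ∀ F : Set E, F.encard < 3 →
    Joined (G.deleteEdges F) s t → Joined ((G.restrict H).deleteEdges F) s t

/-- `H` satisfies the (absolute) demand `r(u,v) = 3`. -/
def Satisfies {V E : Type*} (G : Graph V E) (H : Set E) (u v : V) : Prop :=
  EdgeReachable (G.restrict H) 3 u v

/-- `X` is a `2`-`st`-cut of `G`: an `st`-cut with exactly two edges. -/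
def IsTwoCut {V E : Type*} (G : Graph V E) (s t : V) (X : Set E) : Prop :=
  X.encard = 2 ∧ ∃ A : Set V, s ∈ A ∧ t ∉ A ∧ X = cut G A

/-- The forced edges: the edges of the `2`-`st`-cuts. -/
def forced {V E : Type*} (G : Graph V E) (s t : V) : Set E :=
  {e | ∃ X, IsTwoCut G s t X ∧ e ∈ X}

/-! ### The cactus of the `3`-classes -/

/-- The equivalence relation "no `2`-cut separates `u` and `v`"; its classes are the
`3`-classes of `G`. -/
def threeClass {V E : Type*} (G : Graph V E) : Setoid V where
  r u v := ∀ A : Set V, (cut G A).encard = 2 → (u ∈ A ↔ v ∈ A)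
  iseqv :=
    { refl := fun _ _ _ => Iff.rfl
      symm := fun h A hA => (h A hA).symm
      trans := fun h h' A hA => (h A hA).trans (h' A hA) }

/-- The `3`-classes of `G`. -/
abbrev ThreeClass {V E : Type*} (G : Graph V E) : Type _ := Quotient (threeClass G)

/-- The cactus of `G`: every `3`-class is shrunk to a node, and the loops are dropped. -/
def cactus {V E : Type*} (G : Graph V E) : Graph (ThreeClass G) E :=
  (G.map (Quotient.mk (threeClass G))).restrict
    {e | ∃ x y, ¬ (threeClass G) x y ∧ G.IsLink e x y}

/-- A cycle of a multigraph: at least two distinct nodes in cyclic order, and distinct edges, the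
`i`-th of which joins the `i`-th node to the next one. -/
structure Cycle {V E : Type*} (G : Graph V E) where
  /-- the length of the cycle is `len + 2` -/
  len : ℕ
  /-- the nodes in cyclic order -/
  node : Fin (len + 2) → V
  /-- the edges in cyclic order -/
  edge : Fin (len + 2) → E
  node_injective : Function.Injective node
  edge_injective : Function.Injective edge
  isLink : ∀ i, G.IsLink (edge i) (node i) (node (i + 1))

/-- A cycle of the cactus belongs to the `st`-chain if it contains a `2`-`st`-cut of `G`. -/
def InChain {V E : Type*} (G : Graph V E) (s t : V) (Z : Cycle (cactus G)) : Prop :=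
  ∃ X, IsTwoCut G s t X ∧ X ⊆ Set.range Z.edge

/-- A `3`-class is `st`-relevant if it lies on a cycle of the `st`-chain. -/
def Relevant {V E : Type*} (G : Graph V E) (s t : V) (C : ThreeClass G) : Prop :=
  ∃ Z, InChain G s t Z ∧ C ∈ Set.range Z.node

/-- The attachment nodes of the `3`-class `C`: the nodes in `C` that are `s`, or `t`, or an end of
an edge that lies on a cycle of the `st`-chain. -/
def attachment {V E : Type*} (G : Graph V E) (s t : V) (C : ThreeClass G) : Set V :=
  {x | Quotient.mk (threeClass G) x = C ∧
    (x = s ∨ x = t ∨ ∃ Z, InChain G s t Z ∧ ∃ e ∈ Set.range Z.edge, G.Inc e x)}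

/-- The union, over the `st`-relevant `3`-classes, of the cliques on their attachment nodes. -/
def cliqueDemands {V E : Type*} (G : Graph V E) (s t : V) : Set (Sym2 V) :=
  {d | ∃ C, Relevant G s t C ∧
    ∃ x ∈ attachment G s t C, ∃ y ∈ attachment G s t C, x ≠ y ∧ d = s(x, y)}

/-- The union, over the `st`-relevant `3`-classes `C`, of the edge sets of the graphs `T C` on the
attachment nodes of `C`. -/
def graphDemands {V E : Type*} (G : Graph V E) (s t : V)
    (T : (C : ThreeClass G) → SimpleGraph (attachment G s t C)) : Set (Sym2 V) :=
  {d | ∃ C, Relevant G s t C ∧ ∃ x y, (T C).Adj x y ∧ d = s((x : V), (y : V))}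

/-! ### Random access machines and polynomial time

Programs are while-programs over finitely many arrays of natural numbers with indirect addressing.
The only arithmetic operations are addition and truncated subtraction, so a step lengthens
the numbers in the store by at most a constant number of bits, and unit-cost polynomial time is
polynomial time on Turing machines. -/

/-- A store: `σ a i` is the `i`-th entry of the array `a`. -/
abbrev Store : Type := ℕ → ℕ → ℕ

/-- Expressions: constants, array accesses, addition, truncated subtraction. -/
inductive Expr : Type
  | lit (c : ℕ) : Expr
  | get (a : ℕ) (i : Expr) : Expr
  | add (x y : Expr) : Expr
  | sub (x y : Expr) : Expr

/-- The value of an expression. -/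
def Expr.eval (σ : Store) : Expr → ℕ
  | .lit c => c
  | .get a i => σ a (i.eval σ)
  | .add x y => x.eval σ + y.eval σ
  | .sub x y => x.eval σ - y.eval σ

/-- The time to evaluate an expression: one unit for each constant, access and operation. -/
def Expr.cost : Expr → ℕ
  | .lit _ => 1
  | .get _ i => i.cost + 1
  | .add x y => x.cost + y.cost + 1
  | .sub x y => x.cost + y.cost + 1

/-- Programs. A condition holds if its value is not `0`. -/
inductive Prog : Type
  | skip : Prog
  | put (a : ℕ) (i x : Expr) : Prog
  | seq (p q : Prog) : Prog
  | ite (b : Expr) (p q : Prog) : Prog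
  | while (b : Expr) (p : Prog) : Prog

/-- The store after the `i`-th entry of the array `a` has been set to `x`. -/
def Store.set (σ : Store) (a i x : ℕ) : Store :=
  Function.update σ a (Function.update (σ a) i x)

/-- `Exec p σ τ k`: the program `p`, started in the store `σ`, halts in the store `τ` after
exactly `k` units of time. -/
inductive Exec : Prog → Store → Store → ℕ → Prop
  | skip (σ : Store) : Exec .skip σ σ 1
  | put (a : ℕ) (i x : Expr) (σ : Store) :
      Exec (.put a i x) σ (σ.set a (i.eval σ) (x.eval σ)) (i.cost + x.cost + 1)
  | seq {p q : Prog} {σ τ υ : Store} {k l : ℕ} :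
      Exec p σ τ k → Exec q τ υ l → Exec (.seq p q) σ υ (k + l + 1)
  | ite_true {b : Expr} {p q : Prog} {σ τ : Store} {k : ℕ} :
      b.eval σ ≠ 0 → Exec p σ τ k → Exec (.ite b p q) σ τ (b.cost + k + 1)
  | ite_false {b : Expr} {p q : Prog} {σ τ : Store} {k : ℕ} :
      b.eval σ = 0 → Exec q σ τ k → Exec (.ite b p q) σ τ (b.cost + k + 1)
  | while_true {b : Expr} {p : Prog} {σ τ υ : Store} {k l : ℕ} :
      b.eval σ ≠ 0 → Exec p σ τ k → Exec (.while b p) τ υ l →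
        Exec (.while b p) σ υ (b.cost + k + l + 1)
  | while_false {b : Expr} {p : Prog} {σ : Store} :
      b.eval σ = 0 → Exec (.while b p) σ σ (b.cost + 1)

/-- A multigraph with vertices `0, …, n - 1` and edges `0, …, m - 1`, given by the list of the ends
of its edges, together with the demand pair `s, t`. Loops and parallel edges are allowed. -/
structure Input where
  /-- the number of vertices -/
  n : ℕ
  /-- the number of edges -/
  m : ℕ
  /-- one end of each edge -/
  src : Fin m → Fin n
  /-- the other end of each edge -/
  dst : Fin m → Fin n
  s : Fin n
  t : Fin n

/-- The multigraph of an input. -/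
def Input.graph (I : Input) : Graph (Fin I.n) (Fin I.m) where
  vertexSet := Set.univ
  IsLink e x y := (I.src e = x ∧ I.dst e = y) ∨ (I.src e = y ∧ I.dst e = x)
  isLink_symm := fun _ _ => ⟨fun _ _ h => h.symm⟩
  eq_or_eq_of_isLink_of_isLink := by
    rintro e x y v w (⟨rfl, rfl⟩ | ⟨rfl, rfl⟩) (⟨rfl, rfl⟩ | ⟨rfl, rfl⟩) <;> simp
  left_mem_of_isLink := fun _ _ _ _ => Set.mem_univ _

/-- The instances of the problem: the graph is `2`-edge-connected and `s ≠ t`. -/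
def Input.Valid (I : Input) : Prop :=
  TwoEdgeConnected I.graph ∧ I.s ≠ I.t

/-- The initial store: the array `0` holds `n, m, s, t`, the arrays `1` and `2` hold the two ends of
the edges, and all other entries are `0`. -/
def Input.store (I : Input) : Store
  | 0, 0 => I.n
  | 0, 1 => I.m
  | 0, 2 => I.s
  | 0, 3 => I.t
  | 1, j => if h : j < I.m then (I.src ⟨j, h⟩ : ℕ) else 0
  | 2, j => if h : j < I.m then (I.dst ⟨j, h⟩ : ℕ) else 0
  | _, _ => 0

/-- The store `σ` holds a list of the elements of `D`: the entry `0` of the array `3` is the length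
of the list, and the two ends of its `j`-th pair are the `j`-th entries of the arrays `4`, `5`. -/
def Outputs {n : ℕ} (σ : Store) (D : Set (Sym2 (Fin n))) : Prop :=
  (∀ j < σ 3 0, σ 4 j < n ∧ σ 5 j < n) ∧
  ∀ u v : Fin n, s(u, v) ∈ D ↔
    ∃ j < σ 3 0, (σ 4 j = u ∧ σ 5 j = v) ∨ (σ 4 j = v ∧ σ 5 j = u)

/-- The set `D I` of vertex pairs can be computed from the valid inputs `I`, by one program, in time
polynomial in the number of vertices plus the number of edges. -/
def PolynomiallyComputable (D : (I : Input) → Set (Sym2 (Fin I.n))) : Prop :=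
  ∃ (P : Prog) (p : Polynomial ℕ), ∀ I : Input, I.Valid →
    ∃ (σ : Store) (k : ℕ), Exec P I.store σ k ∧ k ≤ p.eval (I.n + I.m) ∧ Outputs σ (D I)

end RSND

/-! Call `s`, `t` and the ends of forced edges terminals. `D` consists of the pairs of distinct
terminals in a common `3`-class. Write `δ_H(A)` for `cut G A ∩ H`. In terms of cuts
(`feasible_iff`), `H` is feasible iff every `δ_H(A)` with at most two edges, where `A` separates `s`
and `t`, contains an `st`-cut of `G`.

Feasibility implies the demands (`Feasible.satisfies`). Let `δ_H(A)` have at most two edges and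
separate terminals `x`, `y` of one class. Feasibility, together with uncrossing against a
`2`-`st`-cut through a forced edge at `x` if `A` does not separate `s` and `t`, shows that `δ_H(A)`
is a `2`-cut `cut G B` of `G`, where `B` separates `s`, `t` iff `A` does. Since `B` does not split
the class, `A △ B` separates `x` and `y`; but no edge of `H` leaves `A △ B`, so a terminal is cut
off from `s` and `t` in `H`. This contradicts `Feasible.not_isTerminal`.

The demands imply feasibility because a `2`-cut separating two terminals consists of forced edges
(`cut_subset_forced`). Terminals in one component of `G` minus the forced edges thus share a class,
and no `A` with `|δ_H(A)| ≤ 2` separates them. The union of the components of the terminals in `A`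
agrees with `A` on all terminals, and only forced edges leave it; these have terminal ends, so its
cut lies in `δ_H(A)`.

The cycles of the `st`-chain consist exactly of the forced edges (`InChain.edge_mem_forced`,
`exists_inChain_of_mem_forced`), so attachment nodes are terminals. Trees may replace cliques
because satisfied demands compose. The program tries all pairs of deleted edges and tests
reachability. -/

namespace RSND

open Set

/-! ### Cuts, connectivity and forced edges in terms of separating sets -/

section Cuts

variable {V E : Type*} {G : Graph V E} {A B : Set V} {u v w x y s t : V} {e h k : E} {H F : Set E}

/-- The set `A` separates `u` from `v`. -/
def Separates (A : Set V) (u v : V) : Prop := ¬ (u ∈ A ↔ v ∈ A)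

theorem Separates.symm (h : Separates A u v) : Separates A v u := fun h' => h h'.symm

theorem separates_compl : Separates Aᶜ u v ↔ Separates A u v := by
  simp only [Separates, mem_compl_iff, not_iff_not]

theorem separates_symmDiff :
    Separates (symmDiff A B) u v ↔ ¬ (Separates A u v ↔ Separates B u v) := by
  simp only [Separates, mem_symmDiff]; tauto

theorem mem_cut_iff (h : G.IsLink e x y) : e ∈ cut G A ↔ Separates A x y := by
  constructor
  · rintro ⟨a, ha, b, hb, hab⟩
    unfold Separates
    rcases h.eq_and_eq_or_eq_and_eq hab with ⟨rfl, rfl⟩ | ⟨rfl, rfl⟩ <;> tauto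
  · intro hs
    by_cases hx : x ∈ A
    · exact ⟨x, hx, y, fun hy => hs (by tauto), h⟩
    · exact ⟨y, by unfold Separates at hs; tauto, x, hx, h.symm⟩

theorem exists_isLink_of_mem_cut (h : e ∈ cut G A) : ∃ x y, G.IsLink e x y := by
  obtain ⟨x, -, y, -, h⟩ := h
  exact ⟨x, y, h⟩

theorem cut_compl : cut G Aᶜ = cut G A := by
  ext e
  constructor <;> intro h <;> obtain ⟨x, y, hl⟩ := exists_isLink_of_mem_cut h <;>
    simpa only [mem_cut_iff hl, separates_compl] using h

theorem cut_symmDiff : cut G (symmDiff A B) = symmDiff (cut G A) (cut G B) := by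
  ext e
  by_cases h : ∃ x y, G.IsLink e x y
  · obtain ⟨x, y, hl⟩ := h
    rw [mem_symmDiff, mem_cut_iff hl, mem_cut_iff hl, mem_cut_iff hl, separates_symmDiff]
    tauto
  · have h' : ∀ A, e ∉ cut G A := fun A hA => h (exists_isLink_of_mem_cut hA)
    simp [mem_symmDiff, h']

/-- For `s, t ∉ A`, both `B \ A` and `A ∪ B` separate `s` and `t` whenever `B` does, so this
expresses the cut of `A` through two `st`-cuts. -/
theorem cut_eq_symmDiff_cut_sdiff_cut_union :
    cut G A = symmDiff (cut G (B \ A)) (cut G (A ∪ B)) := by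
  rw [← cut_symmDiff]
  congr 1
  ext a; simp only [mem_symmDiff, mem_sdiff, mem_union]; tauto

theorem cut_restrict : cut (G.restrict H) A = cut G A ∩ H := by
  ext e
  simp only [cut, Graph.restrict_isLink, mem_ofPred_eq, mem_inter_iff]
  constructor
  · rintro ⟨x, hx, y, hy, h⟩; exact ⟨⟨x, hx, y, hy, by tauto⟩, by tauto⟩
  · rintro ⟨⟨x, hx, y, hy, h⟩, h'⟩; exact ⟨x, hx, y, hy, by tauto⟩

theorem cut_deleteEdges : cut (G.deleteEdges F) A = cut G A \ F := by
  ext e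
  simp only [cut, Graph.deleteEdges_isLink, mem_ofPred_eq, mem_sdiff]
  constructor
  · rintro ⟨x, hx, y, hy, h⟩; exact ⟨⟨x, hx, y, hy, by tauto⟩, by tauto⟩
  · rintro ⟨⟨x, hx, y, hy, h⟩, h'⟩; exact ⟨x, hx, y, hy, by tauto⟩

theorem joined_iff : Joined G u v ↔ ∀ A, Separates A u v → (cut G A).Nonempty := by
  constructor
  · intro h A hA
    induction h with
    | refl => exact absurd Iff.rfl hA
    | @tail b c _ hbc ih =>
      by_cases hb : Separates A u b
      · exact ih hb
      · obtain ⟨e, he⟩ := hbc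
        exact ⟨e, (mem_cut_iff he).2 (by unfold Separates at *; tauto)⟩
  · intro h
    by_contra hn
    obtain ⟨e, x, hx, y, hy, he⟩ := h {w | Joined G u w} (fun h' => hn (h'.1 .refl))
    exact hy (Relation.ReflTransGen.tail hx ⟨e, he⟩)

theorem edgeReachable_iff {n : ℕ} :
    EdgeReachable G n u v ↔ ∀ A, Separates A u v → n ≤ (cut G A).encard := by
  simp only [EdgeReachable, joined_iff, cut_deleteEdges]
  constructor
  · intro h A hA
    by_contra! hlt
    obtain ⟨e, he⟩ := h _ hlt A hA
    exact he.2 he.1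
  · intro h F hF A hA
    rw [sdiff_nonempty]
    exact fun hs => absurd (h A hA) (not_le.2 ((encard_le_encard hs).trans_lt hF))

theorem EdgeReachable.trans {n : ℕ} (h : EdgeReachable G n u v) (h' : EdgeReachable G n v w) :
    EdgeReachable G n u w :=
  fun F hF => Relation.ReflTransGen.trans (h F hF) (h' F hF)

theorem EdgeReachable.refl {n : ℕ} : EdgeReachable G n u u := fun _ _ => .refl

/-- If `F` disconnects `s` from `t` in `H` through `A`, then `F` contains `δ_H(A)`, so the only
failures that matter are `F = δ_H(A)`. -/
theorem feasible_iff :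
    Feasible G s t H ↔ ∀ A, Separates A s t → (cut G A ∩ H).encard < 3 →
      ∃ B, Separates B s t ∧ cut G B ⊆ cut G A ∩ H := by
  simp only [Feasible, joined_iff, cut_deleteEdges, cut_restrict]
  constructor
  · intro h A hA hlt
    by_contra! hB
    obtain ⟨e, he⟩ := h _ hlt (fun B hB' => sdiff_nonempty.2 (hB B hB')) A hA
    exact he.2 he.1
  · intro h F hF hj A hA
    rw [sdiff_nonempty]
    intro hs
    obtain ⟨B, hB, hBs⟩ := h A hA ((encard_le_encard hs).trans_lt hF)
    exact sdiff_nonempty.1 (hj B hB) (hBs.trans hs)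

theorem mem_forced_iff :
    e ∈ forced G s t ↔ ∃ B, Separates B s t ∧ (cut G B).encard = 2 ∧ e ∈ cut G B := by
  constructor
  · rintro ⟨_, ⟨hX, A, hs, ht, rfl⟩, he⟩
    exact ⟨A, fun h => ht (h.1 hs), hX, he⟩
  · rintro ⟨B, hB, h2, he⟩
    refine ⟨_, ⟨h2, ?_⟩, he⟩
    by_cases hs : s ∈ B
    · exact ⟨B, hs, fun ht => hB (by tauto), rfl⟩
    · exact ⟨Bᶜ, hs, by unfold Separates at hB; simp; tauto, cut_compl.symm⟩

theorem TwoEdgeConnected.two_le (hG : TwoEdgeConnected G) (hV : G.vertexSet = univ)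
    (hA : Separates A u v) : 2 ≤ (cut G A).encard :=
  edgeReachable_iff.1 (hG u (by simp [hV]) v (by simp [hV])) A hA

theorem threeClass_iff : (threeClass G) u v ↔ ∀ A, (cut G A).encard = 2 → ¬ Separates A u v := by
  simp only [Separates, not_not]; rfl

theorem encard_pair_le_two {e f : E} : ({e, f} : Set E).encard ≤ 2 := by
  exact (encard_insert_le {f} e).trans (by rw [encard_singleton, one_add_one_eq_two])

/-- A separating cut inside `{e, f}` has at least two edges, hence equals `{e, f}`; the case `e = f`
is harmless. This and `mem_forced_joined_iff` are the forms that the program tests. -/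
theorem threeClass_joined_iff (hG : TwoEdgeConnected G) (hV : G.vertexSet = univ) :
    (threeClass G) u v ↔ ∀ e f, Joined (G.deleteEdges {e, f}) u v := by
  rw [threeClass_iff]
  simp only [joined_iff, cut_deleteEdges, sdiff_nonempty]
  constructor
  · intro h e f A hA hs
    exact h A (((encard_le_encard hs).trans (encard_pair_le_two)).antisymm (hG.two_le hV hA)) hA
  · intro h A hA hS
    obtain ⟨e, f, -, hef⟩ := encard_eq_two.1 hA
    exact h e f A hS hef.le

theorem mem_forced_joined_iff (hG : TwoEdgeConnected G) (hV : G.vertexSet = univ) :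
    e ∈ forced G s t ↔ ∃ f, ¬ Joined (G.deleteEdges {e, f}) s t := by
  simp only [joined_iff, cut_deleteEdges, not_forall, not_nonempty_iff_eq_empty, sdiff_eq_empty]
  rw [mem_forced_iff]
  constructor
  · rintro ⟨B, hB, h2, he⟩
    obtain ⟨a, b, -, hab⟩ := encard_eq_two.1 h2
    rw [hab] at he
    rcases he with rfl | he
    · exact ⟨b, B, hB, hab.le⟩
    · rw [mem_singleton_iff] at he; subst he
      exact ⟨a, B, hB, by rw [hab, pair_comm]⟩
  · rintro ⟨f, A, hA, hs⟩
    have h2 : (cut G A).encard = 2 :=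
      ((encard_le_encard hs).trans (encard_pair_le_two)).antisymm (hG.two_le hV hA)
    refine ⟨A, hA, h2, ?_⟩
    have hfin : (cut G A).Finite := finite_of_encard_eq_coe h2
    by_contra he
    have : cut G A ⊆ {f} := fun a ha => by
      rcases hs ha with rfl | h
      · exact absurd ha he
      · exact h
    have := encard_le_encard this
    rw [h2, encard_singleton] at this
    exact absurd this (by norm_num)

theorem le_edgeConn_iff {n : ℕ∞} :
    n ≤ edgeConn G u v ↔ ∀ A, Separates A u v → n ≤ (cut G A).encard := by
  simp only [edgeConn, le_iInf_iff, mem_ofPred_eq]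
  constructor
  · intro h A hA
    by_cases hu : u ∈ A
    · exact h A ⟨hu, fun hv => hA (by tauto)⟩
    · rw [← cut_compl]
      exact h Aᶜ ⟨hu, by unfold Separates at hA; simp; tauto⟩
  · exact fun h A hA => h A fun h' => hA.2 (h'.1 hA.1)

theorem three_le_edgeConn_iff (hG : TwoEdgeConnected G) (hV : G.vertexSet = univ) :
    3 ≤ edgeConn G u v ↔ (threeClass G) u v := by
  rw [le_edgeConn_iff, threeClass_iff]
  constructor
  · intro h A hA hS
    have := h A hS
    rw [hA] at this
    exact absurd this (by norm_num)
  · intro h A hA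
    have h2 := hG.two_le hV hA
    have hne : (2 : ℕ∞) ≠ (cut G A).encard := fun h' => h A h'.symm hA
    exact Order.add_one_le_of_lt (lt_of_le_of_ne h2 hne)

/-- The terminals: `s`, `t`, and the ends of the forced edges. -/
def IsTerminal (G : Graph V E) (s t x : V) : Prop :=
  x = s ∨ x = t ∨ ∃ e ∈ forced G s t, G.Inc e x

end Cuts

/-! ### Uncrossing, and the equivalence of feasibility with the terminal demands -/

section Uncrossing

variable {V E : Type*} [Finite E] {G K : Graph V E} {A B : Set V} {x y z s t : V} {h k : E}
  {H : Set E}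

theorem encard_eq_two_iff_ncard {X : Set E} : X.encard = 2 ↔ X.ncard = 2 := by
  rw [← X.toFinite.cast_ncard_eq]; norm_cast

theorem two_le_encard_iff_ncard {X : Set E} : 2 ≤ X.encard ↔ 2 ≤ X.ncard := by
  rw [← X.toFinite.cast_ncard_eq]; norm_cast

theorem encard_lt_three_iff_ncard {X : Set E} : X.encard < 3 ↔ X.ncard ≤ 2 := by
  rw [← X.toFinite.cast_ncard_eq, ← Nat.lt_succ_iff]; norm_cast

/-- Uncrossing of two cuts with at most two edges, one of which has an edge inside of the other
side. -/
theorem ncard_cut_sdiff_of_inside (hA : (cut K A).ncard ≤ 2) (hB : (cut K B).ncard ≤ 2)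
    (hl : K.IsLink h x z) (hx : x ∈ A) (hz : z ∈ A) (hh : h ∈ cut K B)
    (h1 : 2 ≤ (cut K (B \ A)).ncard) (h2 : 2 ≤ (cut K (A ∪ B)).ncard) :
    (cut K (B \ A)).ncard ≤ 2 ∧ (cut K (A ∪ B)).ncard ≤ 2 ∧ (cut K A).ncard = 2 := by
  -- Both ends of `h` lie in `A`, so `h` crosses neither `B \ A` nor `A ∪ B`. This saving bounds the
  -- sum of the two cut sizes by `|cut K A| + 2 (|cut K B| - 1) ≤ 4`, which forces equality
  -- throughout.
  have hsub : cut K (B \ A) ∪ cut K (A ∪ B) ⊆ cut K A ∪ cut K B \ {h} := by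
    rintro e he
    obtain ⟨a, b, hab⟩ : ∃ a b, K.IsLink e a b := by
      rcases he with he | he <;> exact exists_isLink_of_mem_cut he
    have hne : e ≠ h := by
      rintro rfl
      simp only [mem_union, mem_cut_iff hl, Separates, mem_sdiff] at he
      tauto
    simp only [mem_union, mem_cut_iff hab, Separates, mem_sdiff, mem_singleton_iff] at he ⊢
    tauto
  have hint : cut K (B \ A) ∩ cut K (A ∪ B) ⊆ cut K B \ {h} := by
    rintro e he
    have h' : e ∉ cut K A := by
      rw [cut_eq_symmDiff_cut_sdiff_cut_union (B := B), mem_symmDiff]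
      simp only [mem_inter_iff] at he; tauto
    exact (hsub (Or.inl he.1)).resolve_left h'
  have e1 := ncard_union_add_ncard_inter (cut K (B \ A)) (cut K (A ∪ B))
  have e2 := ncard_le_ncard hsub
  have e3 := ncard_le_ncard hint
  have e4 := ncard_union_le (cut K A) (cut K B \ {h})
  have e5 := ncard_sdiff_singleton_add_one hh
  omega

/-- Since `a` and `b` share `h`, the set `(a ∪ b) \ {h}` has at most two elements, so `q` fills it
and `a ∩ b = {h}`. Used when the forced edge `h` leaves `A`. -/
theorem eq_symmDiff_of_ncard {a b q : Set E} (ha : h ∈ a) (hb : h ∈ b) (ha2 : a.ncard ≤ 2)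
    (hb2 : b.ncard ≤ 2) (hq : h ∉ q) (hqs : q ⊆ a ∪ b) (hq2 : 2 ≤ q.ncard) :
    q.ncard ≤ 2 ∧ a.ncard = 2 ∧ a = symmDiff q b := by
  have hqs' : q ⊆ (a ∪ b) \ {h} := fun e he => ⟨hqs he, fun h' => hq (by rwa [← h'])⟩
  have e1 := ncard_union_add_ncard_inter a b
  have e2 := ncard_le_ncard hqs'
  have e3 := ncard_sdiff_singleton_add_one (s := a ∪ b) (Or.inl ha)
  have e4 : ({h} : Set E).ncard ≤ (a ∩ b).ncard := ncard_le_ncard (by simp [ha, hb])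
  rw [ncard_singleton] at e4
  have hI : {h} = a ∩ b :=
    eq_of_subset_of_ncard_le (by simp [ha, hb]) (by rw [ncard_singleton]; omega)
  have hQ : q = (a ∪ b) \ {h} := eq_of_subset_of_ncard_le hqs' (by omega)
  refine ⟨by omega, by omega, ?_⟩
  rw [hQ, hI]
  ext e; simp only [mem_symmDiff, mem_sdiff, mem_union, mem_inter_iff]; tauto

theorem separates_sdiff_of_notMem (hB : Separates B s t) (hs : s ∉ A) (ht : t ∉ A) :
    Separates (B \ A) s t := by
  simp only [Separates, mem_sdiff] at *; tauto

theorem separates_union_of_notMem (hB : Separates B s t) (hs : s ∉ A) (ht : t ∉ A) :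
    Separates (A ∪ B) s t := by
  simp only [Separates, mem_union] at *; tauto

/-- A `2`-cut that separates two terminals consists of forced edges. -/
theorem cut_subset_forced (hG : TwoEdgeConnected G) (hV : G.vertexSet = univ)
    (hx : IsTerminal G s t x) (hy : IsTerminal G s t y) (hA : (cut G A).encard = 2)
    (hxy : Separates A x y) : cut G A ⊆ forced G s t := by
  by_cases hst : Separates A s t
  · exact fun e he => mem_forced_iff.2 ⟨A, hst, hA, he⟩
  wlog hs : s ∉ A generalizing A
  · rw [← cut_compl]
    exact this (by rwa [cut_compl]) (separates_compl.2 hxy) (by rwa [separates_compl])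
      (by simpa using hs)
  wlog hxA : x ∈ A generalizing x y
  · exact this hy hx hxy.symm (by unfold Separates at hxy; tauto)
  have ht : t ∉ A := by unfold Separates at hst; tauto
  obtain rfl | rfl | ⟨h, hf, z, hl⟩ := hx
  · exact absurd hxA hs
  · exact absurd hxA ht
  obtain ⟨B, hB, hB2, hhB⟩ := mem_forced_iff.1 hf
  -- If `h` lies inside `A`, uncrossing makes `B \ A` and `A ∪ B` two `2`-`st`-cuts that cover `cut
  -- G A`. If `h` leaves `A`, it cancels in `A △ B`, which leaves an `st`-cut with at most two
  -- edges.
  by_cases hz : z ∈ A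
  · have h1 := hG.two_le hV (separates_sdiff_of_notMem hB hs ht)
    have h2 := hG.two_le hV (separates_union_of_notMem hB hs ht)
    have h3 := ncard_cut_sdiff_of_inside (encard_eq_two_iff_ncard.1 hA).le
      (encard_eq_two_iff_ncard.1 hB2).le hl hxA hz hhB (two_le_encard_iff_ncard.1 h1)
      (two_le_encard_iff_ncard.1 h2)
    rw [two_le_encard_iff_ncard] at h1 h2
    intro e he
    rw [cut_eq_symmDiff_cut_sdiff_cut_union (B := B), mem_symmDiff] at he
    rw [mem_forced_iff]
    rcases he with he | he
    · exact ⟨_, separates_sdiff_of_notMem hB hs ht,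
        encard_eq_two_iff_ncard.2 (h3.1.antisymm h1), he.1⟩
    · exact ⟨_, separates_union_of_notMem hB hs ht,
        encard_eq_two_iff_ncard.2 (h3.2.1.antisymm h2), he.1⟩
  · have hhA : h ∈ cut G A := ⟨x, hxA, z, hz, hl⟩
    have hD : Separates (symmDiff A B) s t := by rw [separates_symmDiff]; tauto
    intro e he
    by_cases heB : e ∈ cut G B
    · exact mem_forced_iff.2 ⟨B, hB, hB2, heB⟩
    refine mem_forced_iff.2 ⟨_, hD, ?_, by rw [cut_symmDiff, mem_symmDiff]; tauto⟩
    refine le_antisymm ?_ (hG.two_le hV hD)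
    rw [cut_symmDiff, ← Nat.cast_two, ← (toFinite _).cast_ncard_eq, Nat.cast_le]
    have e1 : symmDiff (cut G A) (cut G B) ⊆ (cut G A \ {h}) ∪ (cut G B \ {h}) := by
      rintro e (⟨h1, h2⟩ | ⟨h1, h2⟩)
      · exact Or.inl ⟨h1, by rintro rfl; exact h2 hhB⟩
      · exact Or.inr ⟨h1, by rintro rfl; exact h2 hhA⟩
    have e2 := ncard_le_ncard e1
    have e3 := ncard_union_le (cut G A \ {h}) (cut G B \ {h})
    have e4 := ncard_sdiff_singleton_add_one hhA
    have e5 := ncard_sdiff_singleton_add_one hhB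
    have e6 := encard_eq_two_iff_ncard.1 hA
    have e7 := encard_eq_two_iff_ncard.1 hB2
    omega

/-- A small `st`-cut of a feasible solution is a `2`-`st`-cut of `G`. -/
theorem Feasible.exists_cut_eq (hG : TwoEdgeConnected G) (hV : G.vertexSet = univ)
    (hf : Feasible G s t H) (hA : Separates A s t) (hA2 : (cut G A ∩ H).ncard ≤ 2) :
    ∃ B, Separates B s t ∧ cut G B = cut G A ∩ H ∧ (cut G A ∩ H).ncard = 2 := by
  obtain ⟨B, hB, hBA⟩ := feasible_iff.1 hf A hA (encard_lt_three_iff_ncard.2 hA2)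
  have h2 := two_le_encard_iff_ncard.1 (hG.two_le hV hB)
  have := ncard_le_ncard hBA
  exact ⟨B, hB, eq_of_subset_of_ncard_le hBA (by omega), by omega⟩

theorem Feasible.two_le (hG : TwoEdgeConnected G) (hV : G.vertexSet = univ)
    (hf : Feasible G s t H) (hA : Separates A s t) : 2 ≤ (cut G A ∩ H).ncard := by
  by_contra! hlt
  obtain ⟨-, -, -, h⟩ := hf.exists_cut_eq hG hV hA (by omega)
  omega

/-- No terminal is cut off from `s` and `t` in a feasible solution. -/
theorem Feasible.not_isTerminal (hG : TwoEdgeConnected G) (hV : G.vertexSet = univ)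
    (hH : forced G s t ⊆ H) (hf : Feasible G s t H) (hA : cut G A ∩ H = ∅) (hs : s ∉ A)
    (ht : t ∉ A) (hxA : x ∈ A) : ¬ IsTerminal G s t x := by
  rintro (rfl | rfl | ⟨h, hh, z, hl⟩)
  · exact hs hxA
  · exact ht hxA
  obtain ⟨B, hB, hB2, hhB⟩ := mem_forced_iff.1 hh
  have hzA : z ∈ A := by
    by_contra hz
    have : h ∈ cut G A ∩ H := ⟨⟨x, hxA, z, hz, hl⟩, hH hh⟩
    simp [hA] at this
  have h1 := hf.two_le hG hV (separates_sdiff_of_notMem hB hs ht)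
  -- As no edge of `H` leaves `A`, removing `A` from `B` creates no new cut edge in `H` and loses
  -- `h`, so `H` would have an `st`-cut with one edge.
  have hsub : cut G (B \ A) ∩ H ⊆ cut G B \ {h} := by
    rintro e ⟨he, heH⟩
    obtain ⟨a, b, hab⟩ := exists_isLink_of_mem_cut he
    have hne : e ≠ h := by
      rintro rfl
      simp only [mem_cut_iff hl, Separates, mem_sdiff] at he
      tauto
    have heA : e ∉ cut G A := fun h' => by
      have : e ∈ cut G A ∩ H := ⟨h', heH⟩
      simp [hA] at this
    simp only [mem_cut_iff hab, Separates, mem_sdiff, mem_singleton_iff] at he heA ⊢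
    tauto
  have h2 := ncard_le_ncard hsub
  have h3 := ncard_sdiff_singleton_add_one hhB
  have h4 := encard_eq_two_iff_ncard.1 hB2
  omega

/-- The `2`-cut of `B` cannot split a `3`-class, so `A △ B` would separate `x` from `y` without
separating `s` from `t`. The edges of `H` cancel in its cut, which isolates a terminal. -/
theorem Feasible.not_separates_of_cut_eq (hG : TwoEdgeConnected G) (hV : G.vertexSet = univ)
    (hH : forced G s t ⊆ H) (hf : Feasible G s t H) (hx : IsTerminal G s t x)
    (hy : IsTerminal G s t y) (hxy : (threeClass G) x y) (hA : (cut G A ∩ H).ncard = 2)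
    (hAB : cut G B = cut G A ∩ H) (hst : Separates A s t ↔ Separates B s t) :
    ¬ Separates A x y := by
  intro hA'
  have hB : ¬ Separates B x y :=
    threeClass_iff.1 hxy B (encard_eq_two_iff_ncard.2 (by rw [hAB, hA]))
  have hC : Separates (symmDiff A B) x y := by rw [separates_symmDiff]; tauto
  have hC' : ¬ Separates (symmDiff A B) s t := by rw [separates_symmDiff]; tauto
  have hC0 : cut G (symmDiff A B) ∩ H = ∅ := by
    rw [cut_symmDiff, hAB]
    ext e; simp only [mem_symmDiff, mem_inter_iff, mem_empty_iff_false]; tauto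
  generalize symmDiff A B = C at *
  wlog hs : s ∉ C generalizing C
  · exact this Cᶜ (separates_compl.2 hC) (by rwa [separates_compl]) (by rwa [cut_compl])
      (by simpa using hs)
  have ht : t ∉ C := by unfold Separates at hC'; tauto
  by_cases hxC : x ∈ C
  · exact hf.not_isTerminal hG hV hH hC0 hs ht hxC hx
  · exact hf.not_isTerminal hG hV hH hC0 hs ht
      (by unfold Separates at hC; tauto : y ∈ C) hy

theorem Feasible.satisfies (hG : TwoEdgeConnected G) (hV : G.vertexSet = univ)
    (hH : forced G s t ⊆ H) (hf : Feasible G s t H) (hx : IsTerminal G s t x)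
    (hy : IsTerminal G s t y) (hxy : (threeClass G) x y) : Satisfies G H x y := by
  refine edgeReachable_iff.2 fun A hA => ?_
  rw [cut_restrict]
  by_contra! hlt
  rw [Nat.cast_ofNat, encard_lt_three_iff_ncard] at hlt
  by_cases hst : Separates A s t
  · obtain ⟨B, hB, hBA, h2⟩ := hf.exists_cut_eq hG hV hst hlt
    exact hf.not_separates_of_cut_eq hG hV hH hx hy hxy h2 hBA (iff_of_true hst hB) hA
  wlog hs : s ∉ A generalizing A
  · exact this Aᶜ (separates_compl.2 hA) (by rwa [cut_compl]) (by rwa [separates_compl])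
      (by simpa using hs)
  wlog hxA : x ∈ A generalizing x y
  · exact this hy hx ((threeClass G).symm hxy) hA.symm (by unfold Separates at hA; tauto)
  have ht : t ∉ A := by unfold Separates at hst; tauto
  obtain rfl | rfl | ⟨h, hh, z, hl⟩ := id hx
  · exact hs hxA
  · exact ht hxA
  have hhH := hH hh
  obtain ⟨B, hB, hB2, hhB⟩ := mem_forced_iff.1 hh
  have hBH : cut G B ∩ H = cut G B :=
    inter_eq_left.2 fun e he => hH (mem_forced_iff.2 ⟨B, hB, hB2, he⟩)
  rw [encard_eq_two_iff_ncard] at hB2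
  wlog hxB : x ∈ B generalizing B
  · exact this Bᶜ (separates_compl.2 hB) (by rwa [cut_compl]) (by rwa [cut_compl])
      (by rwa [cut_compl]) hxB
  have hQ := separates_sdiff_of_notMem hB hs ht
  have hS := separates_union_of_notMem hB hs ht
  have hQ2 := hf.two_le hG hV hQ
  have hS2 := hf.two_le hG hV hS
  by_cases hz : z ∈ A
  -- Uncrossing takes place in `H`, with the lower bounds supplied by feasibility. The two resulting
  -- cuts lift to `2`-`st`-cuts `Q`, `S` of `G`, and `Q △ S` has cut `δ_H(A)` in all of `G`.
  · have key := ncard_cut_sdiff_of_inside (K := G.restrict H) (A := A) (B := B) (h := h)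
      (x := x) (z := z) (by rwa [cut_restrict]) (by rw [cut_restrict, hBH, hB2])
      (by rw [Graph.restrict_isLink]; tauto) hxA hz (by rw [cut_restrict, hBH]; exact hhB)
      (by rwa [cut_restrict]) (by rwa [cut_restrict])
    rw [cut_restrict, cut_restrict, cut_restrict] at key
    obtain ⟨Q, hQst, hQe, -⟩ := hf.exists_cut_eq hG hV hQ key.1
    obtain ⟨S, hSst, hSe, -⟩ := hf.exists_cut_eq hG hV hS key.2.1
    have hD : ¬ Separates (symmDiff Q S) s t := by rw [separates_symmDiff]; tauto
    have hcut : cut G (symmDiff Q S) = cut G A ∩ H := by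
      rw [cut_symmDiff, hQe, hSe, cut_eq_symmDiff_cut_sdiff_cut_union (A := A) (B := B)]
      ext e; simp only [mem_symmDiff, mem_inter_iff]; tauto
    refine hf.not_separates_of_cut_eq hG hV hH hx hy hxy key.2.2 hcut (iff_of_false hst hD) hA
  · have hzB : z ∉ B := fun hzB => by
      rw [mem_cut_iff hl] at hhB
      unfold Separates at hhB; tauto
    -- With `x ∈ A ∩ B` and `z ∉ A ∪ B`, the edge `h` lies in both given cuts and avoids that of `B
    -- \ A`. Here `Q △ B` plays the role of `Q △ S`.
    obtain ⟨key, hA2, hcut⟩ := eq_symmDiff_of_ncard (h := h) (a := cut G A ∩ H) (b := cut G B)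
      (q := cut G (B \ A) ∩ H) ⟨⟨x, hxA, z, hz, hl⟩, hhH⟩ hhB hlt hB2.le
      (by simp only [mem_inter_iff, mem_cut_iff hl, Separates, mem_sdiff]; tauto)
      (by
        rintro e ⟨he, heH⟩
        obtain ⟨a, b, hab⟩ := exists_isLink_of_mem_cut he
        simp only [mem_union, mem_inter_iff, mem_cut_iff hab, Separates, mem_sdiff] at he ⊢
        tauto) hQ2
    obtain ⟨Q, hQst, hQe, -⟩ := hf.exists_cut_eq hG hV hQ key
    have hD : ¬ Separates (symmDiff Q B) s t := by rw [separates_symmDiff]; tauto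
    have hcut' : cut G (symmDiff Q B) = cut G A ∩ H := by rw [cut_symmDiff, hQe, hcut]
    refine hf.not_separates_of_cut_eq hG hV hH hx hy hxy hA2 hcut' (iff_of_false hst hD) hA

/-- For a set `H` that contains the forced edges, the relative demand `r(s,t) = 3` is equivalent to
the demands `r(x,y) = 3` for the pairs of terminals in a common `3`-class. -/
theorem feasible_iff_satisfies (hG : TwoEdgeConnected G) (hV : G.vertexSet = univ)
    (hH : forced G s t ⊆ H) :
    Feasible G s t H ↔ ∀ x y, IsTerminal G s t x → IsTerminal G s t y →
      (threeClass G) x y → Satisfies G H x y := by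
  refine ⟨fun hf x y hx hy hxy => hf.satisfies hG hV hH hx hy hxy, fun hD => ?_⟩
  -- A `2`-cut separating two terminals would vanish entirely with the forced edges.
  have hT : ∀ x y, IsTerminal G s t x → IsTerminal G s t y →
      Joined (G.deleteEdges (forced G s t)) x y → (threeClass G) x y := by
    intro x y hx hy hj
    refine threeClass_iff.2 fun A hA hxy => ?_
    have h1 := cut_subset_forced hG hV hx hy hA hxy
    have h2 := joined_iff.1 hj A hxy
    rw [cut_deleteEdges, sdiff_nonempty] at h2
    exact h2 h1
  refine feasible_iff.2 fun A hA hA3 => ?_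
  have hside : ∀ x y, IsTerminal G s t x → IsTerminal G s t y →
      Joined (G.deleteEdges (forced G s t)) x y → x ∈ A → y ∈ A := by
    intro x y hx hy hj hxA
    by_contra hyA
    have := edgeReachable_iff.1 (hD x y hx hy (hT x y hx hy hj)) A (fun h => hyA (h.1 hxA))
    rw [cut_restrict] at this
    exact absurd hA3 (not_lt.2 this)
  have hs : IsTerminal G s t s := Or.inl rfl
  have ht : IsTerminal G s t t := Or.inr (Or.inl rfl)
  -- Non-terminals may lie on either side of `A`; `B` reassigns them by components of `G` minus the
  -- forced edges.
  set B : Set V := {v | ∃ x, IsTerminal G s t x ∧ x ∈ A ∧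
    Joined (G.deleteEdges (forced G s t)) x v} with hBdef
  have hB : ∀ x, IsTerminal G s t x → (x ∈ B ↔ x ∈ A) := fun x hx =>
    ⟨fun ⟨y, hy, hyA, hj⟩ => hside y x hy hx hj hyA, fun hxA => ⟨x, hx, hxA, .refl⟩⟩
  refine ⟨B, by unfold Separates at *; rwa [hB s hs, hB t ht], ?_⟩
  rintro e ⟨a, ha, b, hb, hl⟩
  have hef : e ∈ forced G s t := by
    by_contra hef
    obtain ⟨x, hx, hxA, hj⟩ := ha
    exact hb ⟨x, hx, hxA, hj.tail ⟨e, by rw [Graph.deleteEdges_isLink]; exact ⟨hl, hef⟩⟩⟩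
  have ha' : IsTerminal G s t a := Or.inr (Or.inr ⟨e, hef, b, hl⟩)
  have hb' : IsTerminal G s t b := Or.inr (Or.inr ⟨e, hef, a, hl.symm⟩)
  rw [hB a ha'] at ha
  rw [hB b hb'] at hb
  exact ⟨⟨a, ha, b, hb, hl⟩, hH hef⟩

end Uncrossing

/-! ### Simple paths and maximal runs of indices -/

section Paths

theorem exists_injective_path {α : Type*} {r : α → α → Prop} {a b : α}
    (h : Relation.ReflTransGen r a b) :
    ∃ (n : ℕ) (p : ℕ → α), p 0 = a ∧ p n = b ∧ (∀ i < n, r (p i) (p (i + 1))) ∧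
      ∀ i j, i ≤ n → j ≤ n → p i = p j → i = j := by
  induction h with
  | refl => exact ⟨0, fun _ => a, rfl, rfl, by simp, fun i j hi hj _ => by omega⟩
  | @tail b c _ hbc ih =>
    obtain ⟨n, p, h0, hn, hr, hinj⟩ := ih
    -- If the new vertex is already on the path, the path is truncated there.
    by_cases hc : ∃ i ≤ n, p i = c
    · obtain ⟨i, hi, rfl⟩ := hc
      exact ⟨i, p, h0, rfl, fun j hj => hr j (by omega),
        fun j k hj hk => hinj j k (by omega) (by omega)⟩
    · push Not at hc
      have hp : ∀ i ≤ n, Function.update p (n + 1) c i = p i := fun i hi =>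
        Function.update_of_ne (by omega) _ _
      have hp' : Function.update p (n + 1) c (n + 1) = c := Function.update_self _ _ _
      refine ⟨n + 1, Function.update p (n + 1) c, by rw [hp 0 (by omega), h0], hp', ?_, ?_⟩
      · intro i hi
        rcases (show i ≤ n by omega).eq_or_lt with rfl | hlt
        · rw [hp', hp i le_rfl, hn]; exact hbc
        · rw [hp i (by omega), hp (i + 1) (by omega)]; exact hr i hlt
      · intro i j hi hj hij
        rcases hi.eq_or_lt with rfl | hi <;> rcases hj.eq_or_lt with rfl | hj
        · rfl
        · rw [hp', hp j (by omega)] at hij; exact absurd hij.symm (hc j (by omega))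
        · rw [hp', hp i (by omega)] at hij; exact absurd hij (hc i (by omega))
        · rw [hp i (by omega), hp j (by omega)] at hij
          exact hinj i j (by omega) (by omega) hij

theorem iff_of_forall_iff_succ {P : ℕ → Prop} {m n : ℕ} (hmn : m ≤ n)
    (h : ∀ k, m ≤ k → k < n → (P k ↔ P (k + 1))) : P m ↔ P n := by
  induction n, hmn using Nat.le_induction with
  | base => rfl
  | succ k hk ih => exact (ih fun i hi hik => h i hi (by omega)).trans (h k hk (by omega))

/-- Later applied to a run of unforced edges on an unrolled cycle. -/
theorem exists_maximal_gap {P : ℕ → Prop} {a j b : ℕ} (ha : P a) (hb : P b) (haj : a < j)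
    (hjb : j < b) (hj : ¬ P j) :
    ∃ a' b', a ≤ a' ∧ a' < j ∧ j < b' ∧ b' ≤ b ∧ P a' ∧ P b' ∧ ∀ i, a' < i → i < b' → ¬ P i := by
  classical
  have h1 : ∃ b', j < b' ∧ P b' := ⟨b, hjb, hb⟩
  refine ⟨Nat.findGreatest P j, Nat.find h1, Nat.le_findGreatest haj.le ha, ?_,
    (Nat.find_spec h1).1, Nat.find_min' h1 ⟨hjb, hb⟩, Nat.findGreatest_spec haj.le ha,
    (Nat.find_spec h1).2, ?_⟩
  · refine lt_of_le_of_ne (Nat.findGreatest_le j) fun h => hj ?_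
    have := Nat.findGreatest_spec haj.le ha
    rwa [h] at this
  · intro i hi hib hPi
    rcases le_or_gt i j with hij | hij
    · exact absurd (Nat.le_findGreatest hij hPi) (by omega)
    · exact Nat.find_min h1 hib ⟨hij, hPi⟩

end Paths

/-! ### The `st`-chain of the cactus and its attachment nodes -/

section Cactus

variable {V E : Type*} {G : Graph V E} {A : Set V} {x y s t : V} {e : E} {C C' : ThreeClass G}

theorem cactus_isLink : (cactus G).IsLink e C C' ↔
    ∃ x y, G.IsLink e x y ∧ ¬ (threeClass G) x y ∧ Quotient.mk _ x = C ∧ Quotient.mk _ y = C' := by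
  simp only [cactus, Graph.restrict_isLink, Graph.map_isLink, Relation.Map, mem_ofPred_eq]
  constructor
  · rintro ⟨⟨x, y, hxy, hl⟩, x', y', hl', rfl, rfl⟩
    refine ⟨x', y', hl', ?_, rfl, rfl⟩
    rcases hl.eq_and_eq_or_eq_and_eq hl' with ⟨rfl, rfl⟩ | ⟨rfl, rfl⟩
    · exact hxy
    · exact fun h => hxy ((threeClass G).symm h)
  · rintro ⟨x, y, hl, hxy, rfl, rfl⟩
    exact ⟨⟨x, y, hxy, hl⟩, x, y, hl, rfl, rfl⟩

/-- The nodes of the cactus that meet `A`. -/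
def nodesOf (G : Graph V E) (A : Set V) : Set (ThreeClass G) := Quotient.mk (threeClass G) '' A

theorem mk_mem_nodesOf (hA : (cut G A).encard = 2) :
    Quotient.mk (threeClass G) x ∈ nodesOf G A ↔ x ∈ A :=
  ⟨fun ⟨_, hy, h⟩ => (Quotient.exact h A hA).1 hy, fun h => ⟨x, h, rfl⟩⟩

theorem mem_cut_of_isLink_cactus (hA : (cut G A).encard = 2) (hl : (cactus G).IsLink e C C') :
    e ∈ cut G A ↔ ¬ (C ∈ nodesOf G A ↔ C' ∈ nodesOf G A) := by
  obtain ⟨x, y, hl', -, rfl, rfl⟩ := cactus_isLink.1 hl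
  rw [mk_mem_nodesOf hA, mk_mem_nodesOf hA, mem_cut_iff hl', Separates]

/-- The ends of a maximal run of unforced edges contain terminals in different `3`-classes. A
`2`-cut separating them consists of forced edges, yet it would have to cross the run. -/
theorem InChain.edge_mem_forced [Finite E] (hG : TwoEdgeConnected G) (hV : G.vertexSet = univ)
    {Z : Cycle (cactus G)} (hZ : InChain G s t Z) (j : Fin (Z.len + 2)) :
    Z.edge j ∈ forced G s t := by
  by_contra hj
  obtain ⟨X, hX, hXZ⟩ := hZ
  obtain ⟨e, f, -, hef⟩ := encard_eq_two.1 hX.1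
  have heX : e ∈ X := by simp [hef]
  obtain ⟨i, hi⟩ := hXZ heX
  have hi' : Z.edge i ∈ forced G s t := ⟨X, hX, by rwa [hi]⟩
  -- The cycle is unrolled to `ℕ`; the window from `i` to `i + len + 2` begins and ends with the
  -- same forced edge, so it bounds a run even if no other edge is forced.
  let c : ℕ → Fin (Z.len + 2) := Fin.ofNat (Z.len + 2)
  have hcv : ∀ k, (c k).val = k % (Z.len + 2) := fun k => rfl
  have hcast : ∀ k : ℕ, c (k + (Z.len + 2)) = c k := fun k => Fin.ext (by simp [hcv])
  have hsucc : ∀ k : ℕ, c (k + 1) = c k + 1 := fun k => Fin.ext (by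
    rw [Fin.val_add, hcv, hcv, Nat.add_mod]; rfl)
  have hval : ∀ k : Fin (Z.len + 2), c k = k := fun k => Fin.ext (Nat.mod_eq_of_lt k.2)
  obtain ⟨k, hik, hki, hk⟩ : ∃ k : ℕ, i.val < k ∧ k < i.val + (Z.len + 2) ∧ c k = j := by
    have hne : i.val ≠ j.val := fun h => hj (by rwa [← Fin.ext h])
    rcases lt_or_gt_of_ne hne with h | h
    · exact ⟨j.val, h, by omega, hval j⟩
    · exact ⟨j.val + (Z.len + 2), by omega, by omega, by rw [hcast, hval]⟩
  obtain ⟨a, b, hia, hak, hkb, hbi, hPa, hPb, hgap⟩ :=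
    exists_maximal_gap (P := fun k : ℕ => Z.edge (c k) ∈ forced G s t) (a := i.val)
      (b := i.val + (Z.len + 2)) (j := k) (by simpa only [hval] using hi')
      (by simpa only [hcast, hval] using hi') hik hki (by simpa only [hk] using hj)
  have hlink : ∀ k : ℕ, (cactus G).IsLink (Z.edge (c k)) (Z.node (c k)) (Z.node (c (k + 1))) := by
    intro k; rw [hsucc]; exact Z.isLink _
  obtain ⟨u, x, hux, -, -, hx⟩ := cactus_isLink.1 (hlink a)
  obtain ⟨y, v, hyv, -, hy, -⟩ := cactus_isLink.1 (hlink b)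
  -- The nodes `a + 1` and `b` differ because `0 < b - (a + 1) < len + 2`.
  have hxy : ¬ (threeClass G) x y := by
    intro h
    have h1 : Quotient.mk (threeClass G) x = Quotient.mk (threeClass G) y := Quotient.sound h
    rw [hx, hy] at h1
    have h2 := congrArg Fin.val (Z.node_injective h1)
    rw [hcv, hcv] at h2
    have h3 : (Z.len + 2) ∣ b - (a + 1) := (Nat.modEq_iff_dvd' (by omega)).1 h2
    have := Nat.le_of_dvd (by omega) h3
    omega
  rw [threeClass_iff] at hxy
  push Not at hxy
  obtain ⟨W, hW, hWxy⟩ := hxy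
  have hWf := cut_subset_forced hG hV (s := s) (t := t) (Or.inr (Or.inr ⟨_, hPa, u, hux.symm⟩))
    (Or.inr (Or.inr ⟨_, hPb, v, hyv⟩)) hW hWxy
  apply hWxy
  rw [← mk_mem_nodesOf hW, ← mk_mem_nodesOf hW, hx, hy]
  refine iff_of_forall_iff_succ (P := fun k : ℕ => Z.node (c k) ∈ nodesOf G W) (by omega) ?_
  intro k hk hkb
  by_contra hne
  exact hgap k (by omega) hkb (hWf ((mem_cut_of_isLink_cactus hW (hlink k)).2 hne))

/-- Every walk of `G` avoiding `e` becomes a walk of the cactus avoiding `e`. -/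
theorem joined_cactus {F : Set E} (h : Joined (G.deleteEdges F) x y) :
    Joined ((cactus G).deleteEdges F) (Quotient.mk _ x) (Quotient.mk _ y) := by
  induction h with
  | refl => exact .refl
  | @tail b c _ hbc ih =>
    by_cases h : (threeClass G) b c
    · rwa [← show Quotient.mk (threeClass G) b = Quotient.mk _ c from Quotient.sound h]
    · obtain ⟨e, he⟩ := hbc
      rw [Graph.deleteEdges_isLink] at he
      refine ih.tail ⟨e, ?_⟩
      rw [Graph.deleteEdges_isLink]
      exact ⟨cactus_isLink.2 ⟨b, c, he.1, h, rfl, rfl⟩, he.2⟩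

/-- The path `p` is returned as well, so that a cut can be followed along the cycle edges other than
`e`. -/
theorem exists_cycle_of_path {W : Type*} {K : Graph W E} {a b : W} (he : K.IsLink e b a)
    (hab : a ≠ b) (h : Joined (K.deleteEdges {e}) a b) :
    ∃ Z : Cycle K, ∃ n : ℕ, ∃ p : ℕ → W, p 0 = a ∧ p n = b ∧ e ∈ range Z.edge ∧
      ∀ i < n, ∃ f ∈ range Z.edge, f ≠ e ∧ K.IsLink f (p i) (p (i + 1)) := by
  obtain ⟨n, p, h0, hn, hadj, hinj⟩ := exists_injective_path h
  have hn0 : n ≠ 0 := by rintro rfl; exact hab (h0.symm.trans hn)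
  obtain ⟨l, rfl⟩ := Nat.exists_eq_succ_of_ne_zero hn0
  rw [Nat.succ_eq_add_one] at *
  have hq : ∀ i, ∃ f, i < l + 1 → f ≠ e ∧ K.IsLink f (p i) (p (i + 1)) := by
    intro i
    by_cases hi : i < l + 1
    · obtain ⟨f, hf⟩ := hadj i hi
      rw [Graph.deleteEdges_isLink] at hf
      exact ⟨f, fun _ => ⟨hf.2, hf.1⟩⟩
    · exact ⟨e, fun h => absurd h hi⟩
  choose q hq using hq
  refine ⟨⟨l, fun i => p i, fun i => if i.val = l + 1 then e else q i, ?_, ?_, ?_⟩,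
    l + 1, p, h0, hn, ⟨Fin.last _, by simp⟩, ?_⟩
  · intro i j hij
    exact Fin.ext (hinj i j (by omega) (by omega) hij)
  · intro i j hij
    have hi := i.2
    have hj := j.2
    dsimp only at hij
    split_ifs at hij with h1 h2 h2
    · exact Fin.ext (h1.trans h2.symm)
    · exact absurd hij.symm (hq j (by omega)).1
    · exact absurd hij (hq i (by omega)).1
    · have hi' := (hq i (by omega)).2
      have hj' := (hq j (by omega)).2
      rw [hij] at hi'
      -- An edge used twice would have the same end pair; the reversed match would need `i = j + 1`
      -- and `i + 1 = j`.
      rcases hi'.eq_and_eq_or_eq_and_eq hj' with ⟨h3, -⟩ | ⟨h3, h4⟩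
      · exact Fin.ext (hinj i j (by omega) (by omega) h3)
      · have := hinj _ _ (by omega) (by omega) h3
        have := hinj _ _ (by omega) (by omega) h4
        omega
  · intro i
    split_ifs with h
    · have : i = Fin.last _ := Fin.ext h
      subst this
      simpa [h0, hn] using he
    · rw [Fin.val_add_one_of_lt (Fin.lt_def.2 (by have := i.2; rw [Fin.val_last]; omega))]
      exact (hq i (by have := i.2; omega)).2
  · intro i hi
    exact ⟨q i, ⟨⟨i, Nat.lt_succ_of_lt hi⟩, if_neg hi.ne⟩, hq i hi⟩

/-- Without `e` the graph is still connected, so `e` closes a cycle in the cactus. The rest of this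
cycle must cross the `2`-`st`-cut of `e` again, necessarily in its other edge. -/
theorem exists_inChain_of_mem_forced (hG : TwoEdgeConnected G)
    (hV : G.vertexSet = univ) (he : e ∈ forced G s t) :
    ∃ Z, InChain G s t Z ∧ e ∈ range Z.edge := by
  obtain ⟨X, hX, heX⟩ := he
  obtain ⟨hX2, B, hs, ht, rfl⟩ := id hX
  obtain ⟨x, y, hl⟩ := exists_isLink_of_mem_cut heX
  have hB := (mem_cut_iff hl).1 heX
  have hxy : ¬ (threeClass G) x y := fun h => threeClass_iff.1 h B hX2 hB
  have hyx : Quotient.mk (threeClass G) y ≠ Quotient.mk _ x :=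
    fun h => hxy ((threeClass G).symm (Quotient.exact h))
  obtain ⟨Z, n, p, h0, hn, heZ, hp⟩ := exists_cycle_of_path
    (cactus_isLink.2 ⟨x, y, hl, hxy, rfl, rfl⟩) hyx
    (joined_cactus (hG y (by simp [hV]) x (by simp [hV]) {e} (by simp)))
  refine ⟨Z, ⟨_, hX, ?_⟩, heZ⟩
  obtain ⟨f, hfZ, hfe, hfB⟩ : ∃ f ∈ range Z.edge, f ≠ e ∧ f ∈ cut G B := by
    by_contra! hno
    refine hB.symm ?_
    rw [← mk_mem_nodesOf hX2, ← mk_mem_nodesOf hX2, ← h0, ← hn]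
    refine iff_of_forall_iff_succ (P := fun k => p k ∈ nodesOf G B) (Nat.zero_le n) ?_
    intro k _ hk
    obtain ⟨f, hfZ, hfe, hlf⟩ := hp k hk
    by_contra hne
    exact hno f hfZ hfe ((mem_cut_of_isLink_cactus hX2 hlf).2 hne)
  intro g hg
  obtain ⟨a, b, -, hab⟩ := encard_eq_two.1 hX2
  rw [hab] at hg heX hfB
  simp only [mem_insert_iff, mem_singleton_iff] at hg heX hfB
  have : g = e ∨ g = f := by
    rcases hg with rfl | rfl <;> rcases heX with rfl | rfl <;> rcases hfB with rfl | rfl <;>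
      first | exact Or.inl rfl | exact Or.inr rfl | exact absurd rfl hfe
  rcases this with rfl | rfl
  · exact heZ
  · exact hfZ

theorem mem_attachment_iff [Finite E] (hG : TwoEdgeConnected G) (hV : G.vertexSet = univ) :
    x ∈ attachment G s t C ↔ Quotient.mk _ x = C ∧ IsTerminal G s t x := by
  simp only [attachment, mem_ofPred_eq, IsTerminal]
  refine and_congr_right fun _ => or_congr_right (or_congr_right ?_)
  constructor
  · rintro ⟨Z, hZ, e, ⟨i, rfl⟩, he⟩
    exact ⟨_, hZ.edge_mem_forced hG hV i, he⟩
  · rintro ⟨e, he, hx⟩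
    obtain ⟨Z, hZ, heZ⟩ := exists_inChain_of_mem_forced hG hV he
    exact ⟨Z, hZ, e, heZ, hx⟩

theorem relevant_of_inc_forced (hG : TwoEdgeConnected G) (hV : G.vertexSet = univ)
    (he : e ∈ forced G s t) (hx : G.Inc e x) : Relevant G s t (Quotient.mk _ x) := by
  obtain ⟨Z, hZ, i, rfl⟩ := exists_inChain_of_mem_forced hG hV he
  refine ⟨Z, hZ, ?_⟩
  obtain ⟨a, b, hab, -, ha, hb⟩ := cactus_isLink.1 (Z.isLink i)
  rcases hx.eq_or_eq_of_isLink hab with rfl | rfl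
  · exact ⟨i, ha.symm⟩
  · exact ⟨i + 1, hb.symm⟩

/-- If `s` and `t` are in different `3`-classes, every `3`-class that contains two terminals is
relevant. -/
theorem relevant_of_isTerminal (hG : TwoEdgeConnected G) (hV : G.vertexSet = univ)
    (hst : ¬ (threeClass G) s t) (hx : IsTerminal G s t x) (hy : IsTerminal G s t y)
    (hne : x ≠ y) (hxy : (threeClass G) x y) : Relevant G s t (Quotient.mk _ x) := by
  have hmk : Quotient.mk (threeClass G) x = Quotient.mk _ y := Quotient.sound hxy
  rcases hx with rfl | rfl | ⟨e, he, hx⟩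
  · rcases hy with rfl | rfl | ⟨e, he, hy⟩
    · exact absurd rfl hne
    · exact absurd hxy hst
    · rw [hmk]; exact relevant_of_inc_forced hG hV he hy
  · rcases hy with rfl | rfl | ⟨e, he, hy⟩
    · exact absurd ((threeClass G).symm hxy) hst
    · exact absurd rfl hne
    · rw [hmk]; exact relevant_of_inc_forced hG hV he hy
  · exact relevant_of_inc_forced hG hV he hx

/-- The demands between distinct terminals in a common `3`-class. -/
def terminalDemands (G : Graph V E) (s t : V) : Set (Sym2 V) :=
  {d | ∃ x y, IsTerminal G s t x ∧ IsTerminal G s t y ∧ x ≠ y ∧ (threeClass G) x y ∧ d = s(x, y)}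

theorem mk_mem_terminalDemands : s(x, y) ∈ terminalDemands G s t ↔
    IsTerminal G s t x ∧ IsTerminal G s t y ∧ x ≠ y ∧ (threeClass G) x y := by
  constructor
  · rintro ⟨a, b, ha, hb, hne, hab, h⟩
    rcases Sym2.eq_iff.1 h with ⟨rfl, rfl⟩ | ⟨rfl, rfl⟩
    · exact ⟨ha, hb, hne, hab⟩
    · exact ⟨hb, ha, hne.symm, (threeClass G).symm hab⟩
  · rintro ⟨ha, hb, hne, hab⟩
    exact ⟨x, y, ha, hb, hne, hab, rfl⟩

theorem feasible_iff_terminalDemands [Finite E] (hG : TwoEdgeConnected G)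
    (hV : G.vertexSet = univ) {H : Set E} (hH : forced G s t ⊆ H) :
    Feasible G s t H ↔ ∀ u v, s(u, v) ∈ terminalDemands G s t → Satisfies G H u v := by
  rw [feasible_iff_satisfies hG hV hH]
  simp only [mk_mem_terminalDemands]
  constructor
  · rintro h u v ⟨hu, hv, -, huv⟩
    exact h u v hu hv huv
  · intro h u v hu hv huv
    by_cases hne : u = v
    · subst hne; exact EdgeReachable.refl
    · exact h u v ⟨hu, hv, hne, huv⟩

theorem terminalDemands_eq_cliqueDemands [Finite E] (hG : TwoEdgeConnected G)
    (hV : G.vertexSet = univ) (hst : ¬ (threeClass G) s t) :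
    terminalDemands G s t = cliqueDemands G s t := by
  ext d
  simp only [cliqueDemands, mem_attachment_iff hG hV, mem_ofPred_eq, terminalDemands]
  constructor
  · rintro ⟨x, y, hx, hy, hne, hxy, rfl⟩
    exact ⟨_, relevant_of_isTerminal hG hV hst hx hy hne hxy, x, ⟨rfl, hx⟩, y,
      ⟨(Quotient.sound hxy).symm, hy⟩, hne, rfl⟩
  · rintro ⟨C, -, x, ⟨hxC, hx⟩, y, ⟨hyC, hy⟩, hne, rfl⟩
    exact ⟨x, y, hx, hy, hne, Quotient.exact (hxC.trans hyC.symm), rfl⟩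

/-- Satisfied demands compose along walks of `T C`, so connectedness suffices to recover every pair
of terminals in the class. -/
theorem feasible_iff_graphDemands [Finite E] (hG : TwoEdgeConnected G)
    (hV : G.vertexSet = univ) (hst : ¬ (threeClass G) s t)
    {T : (C : ThreeClass G) → SimpleGraph (attachment G s t C)}
    (hT : ∀ C, Relevant G s t C → (T C).Connected) {H : Set E} (hH : forced G s t ⊆ H) :
    Feasible G s t H ↔ ∀ u v, s(u, v) ∈ graphDemands G s t T → Satisfies G H u v := by
  rw [feasible_iff_satisfies hG hV hH]
  constructor
  · rintro h u v ⟨C, -, x, y, -, hd⟩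
    obtain ⟨hxC, hx⟩ := (mem_attachment_iff hG hV).1 x.2
    obtain ⟨hyC, hy⟩ := (mem_attachment_iff hG hV).1 y.2
    have hxy : (threeClass G) x y := Quotient.exact (hxC.trans hyC.symm)
    rcases Sym2.eq_iff.1 hd with ⟨rfl, rfl⟩ | ⟨rfl, rfl⟩
    · exact h _ _ hx hy hxy
    · exact h _ _ hy hx ((threeClass G).symm hxy)
  · intro h u v hu hv huv
    by_cases hne : u = v
    · subst hne; exact EdgeReachable.refl
    have hC := relevant_of_isTerminal hG hV hst hu hv hne huv
    have hu' : u ∈ attachment G s t (Quotient.mk _ u) := (mem_attachment_iff hG hV).2 ⟨rfl, hu⟩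
    have hv' : v ∈ attachment G s t (Quotient.mk _ u) :=
      (mem_attachment_iff hG hV).2 ⟨(Quotient.sound huv).symm, hv⟩
    obtain ⟨w⟩ := (hT _ hC).preconnected ⟨u, hu'⟩ ⟨v, hv'⟩
    have key : ∀ a b, (T (Quotient.mk _ u)).Walk a b → Satisfies G H a b := by
      intro a b w
      induction w with
      | nil => exact EdgeReachable.refl
      | cons hab _ ih => exact EdgeReachable.trans (h _ _ ⟨_, hC, _, _, hab, rfl⟩) ih
    exact key _ _ w

end Cactus

/-! ### Counting-loop programs: semantics, running time, invariants -/

section Loops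

theorem Store.set_same (σ : Store) (a i x : ℕ) : σ.set a i x a = Function.update (σ a) i x :=
  Function.update_self _ _ _

theorem Store.set_of_ne {a b : ℕ} (h : b ≠ a) (σ : Store) (i x : ℕ) : σ.set a i x b = σ b :=
  Function.update_of_ne h _ _

theorem Store.set_same_eq_iff (σ : Store) (a i x j : ℕ) :
    σ.set a i x a j = if j = i then x else σ a j := by
  rw [Store.set_same, Function.update_apply]

/-- Programs whose only loops are counting loops: `loop c b p` repeats `p` for the values
`0, 1, …` of the counter (the entry `0` of the array `c`) below the entry `b` of the array `0`. -/
inductive Code : Type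
  | skip : Code
  | put (a : ℕ) (i x : Expr) : Code
  | seq (p q : Code) : Code
  | ite (b : Expr) (p q : Code) : Code
  | loop (c b : ℕ) (p : Code) : Code

namespace Code

/-- The `while`-program of a program with counting loops. -/
def toProg : Code → Prog
  | skip => .skip
  | put a i x => .put a i x
  | seq p q => .seq p.toProg q.toProg
  | ite b p q => .ite b p.toProg q.toProg
  | loop c b p => .seq (.put c (.lit 0) (.lit 0))
      (.while (.sub (.get 0 (.lit b)) (.get c (.lit 0)))
        (.seq p.toProg (.put c (.lit 0) (.add (.get c (.lit 0)) (.lit 1)))))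

/-- The arrays that a program may write. -/
def writes : Code → List ℕ
  | skip => []
  | put a _ _ => [a]
  | seq p q => p.writes ++ q.writes
  | ite _ p q => p.writes ++ q.writes
  | loop c _ p => c :: p.writes

/-- The loop counters are written by their loops only, the array `0` is never written, and all
loop bounds are among the first two entries of the array `0`. -/
def WellFormed : Code → Prop
  | skip => True
  | put _ _ _ => True
  | seq p q => p.WellFormed ∧ q.WellFormed ∧ 0 ∉ p.writes
  | ite _ p q => p.WellFormed ∧ q.WellFormed
  | loop c b p => c ≠ 0 ∧ b < 2 ∧ c ∉ p.writes ∧ 0 ∉ p.writes ∧ p.WellFormed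

/-- The effect of a program on the store. -/
def run : Code → Store → Store
  | skip, σ => σ
  | put a i x, σ => σ.set a (i.eval σ) (x.eval σ)
  | seq p q, σ => q.run (p.run σ)
  | ite b p q, σ => if b.eval σ = 0 then q.run σ else p.run σ
  | loop c b p, σ =>
      (fun τ => (p.run τ).set c 0 (p.run τ c 0 + 1))^[σ 0 b] (σ.set c 0 0)

/-- A bound for the running time of a program in terms of the loop bounds. -/
noncomputable def bound : Code → Polynomial ℕ
  | skip => 1
  | put _ i x => Polynomial.C (i.cost + x.cost + 1)
  | seq p q => p.bound + q.bound + 1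
  | ite b p q => Polynomial.C b.cost + p.bound + q.bound + 1
  -- Per round: condition `5`, increment `6`, and `1` each for `seq` and `while`. Outside:
  -- initialisation `3`, the failing test `6`, and `seq` `1`.
  | loop _ _ p => Polynomial.X * (p.bound + 13) + 10

theorem run_of_notMem_writes {p : Code} {a : ℕ} (h : a ∉ p.writes) (σ : Store) :
    p.run σ a = σ a := by
  induction p generalizing σ with
  | skip => rfl
  | put b i x => exact Store.set_of_ne (by simpa [writes] using h) _ _ _
  | seq p q hp hq =>
    simp only [writes, List.mem_append, not_or] at h
    rw [run, hq h.2, hp h.1]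
  | ite b p q hp hq =>
    simp only [writes, List.mem_append, not_or] at h
    rw [run]
    split_ifs
    · exact hq h.2 σ
    · exact hp h.1 σ
  | loop c b p hp =>
    simp only [writes, List.mem_cons, not_or] at h
    rw [run]
    generalize σ 0 b = n
    induction n with
    | zero => exact Store.set_of_ne h.1 _ _ _
    | succ n ih => rw [Function.iterate_succ_apply', Store.set_of_ne h.1, hp h.2, ih]

/-- A body changes neither its loop counter nor the array `0`, so every loop makes exactly the
number of rounds fixed at its entry, which is at most `M`. -/
theorem exec_toProg {p : Code} (hp : p.WellFormed) {M : ℕ} {σ : Store} (h0 : σ 0 0 ≤ M)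
    (h1 : σ 0 1 ≤ M) : ∃ k, Exec p.toProg σ (p.run σ) k ∧ k ≤ p.bound.eval M := by
  induction p generalizing σ with
  | skip => exact ⟨1, .skip σ, by simp [bound]⟩
  | put a i x => exact ⟨_, .put a i x σ, by simp [bound]⟩
  | seq p q ihp ihq =>
    obtain ⟨hwp, hwq, h0p⟩ := hp
    obtain ⟨k, hk, hkM⟩ := ihp hwp h0 h1
    have hτ := run_of_notMem_writes h0p σ
    obtain ⟨l, hl, hlM⟩ := ihq hwq (σ := p.run σ) (by rwa [hτ]) (by rwa [hτ])
    refine ⟨_, .seq hk hl, ?_⟩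
    simp only [bound, Polynomial.eval_add, Polynomial.eval_one]
    omega
  | ite b p q ihp ihq =>
    obtain ⟨k, hk, hkM⟩ := ihp hp.1 h0 h1
    obtain ⟨l, hl, hlM⟩ := ihq hp.2 h0 h1
    by_cases hb : b.eval σ = 0
    · refine ⟨_, by rw [run, if_pos hb]; exact .ite_false hb hl, ?_⟩
      simp only [bound, Polynomial.eval_add, Polynomial.eval_one, Polynomial.eval_C]
      omega
    · refine ⟨_, by rw [run, if_neg hb]; exact .ite_true hb hk, ?_⟩
      simp only [bound, Polynomial.eval_add, Polynomial.eval_one, Polynomial.eval_C]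
      omega
  | loop c b p ih =>
    obtain ⟨hc, hb, hcp, h0p, hwf⟩ := hp
    -- Here `d` is the number of rounds that remain.
    have key : ∀ (d : ℕ) (τ : Store), τ 0 = σ 0 → τ c 0 + d = σ 0 b → ∃ k,
        Exec (.while (.sub (.get 0 (.lit b)) (.get c (.lit 0)))
          (.seq p.toProg (.put c (.lit 0) (.add (.get c (.lit 0)) (.lit 1))))) τ
          ((fun τ => (p.run τ).set c 0 (p.run τ c 0 + 1))^[d] τ) k ∧
        k ≤ d * (p.bound.eval M + 13) + 6 := by
      intro d
      induction d with
      | zero =>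
        intro τ hτ0 hτc
        exact ⟨_, .while_false (by simp only [Expr.eval, hτ0]; omega), by simp [Expr.cost]⟩
      | succ d ihd =>
        intro τ hτ0 hτc
        obtain ⟨k, hk, hkM⟩ := ih hwf (σ := τ) (by rwa [hτ0]) (by rwa [hτ0])
        have hpc := run_of_notMem_writes hcp τ
        obtain ⟨l, hl, hlM⟩ := ihd ((p.run τ).set c 0 (p.run τ c 0 + 1))
          (by rw [Store.set_of_ne hc.symm, run_of_notMem_writes h0p, hτ0])
          (by rw [Store.set_same_eq_iff, if_pos rfl, hpc]; omega)
        rw [Function.iterate_succ_apply]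
        exact ⟨_, .while_true (by simp only [Expr.eval, hτ0]; omega) (.seq hk (.put _ _ _ _)) hl,
          by simp only [Expr.cost, add_mul]; omega⟩
    obtain ⟨k, hk, hkM⟩ := key (σ 0 b) (σ.set c 0 0) (Store.set_of_ne hc.symm _ _ _)
      (by rw [Store.set_same_eq_iff, if_pos rfl, zero_add])
    refine ⟨_, .seq (.put _ _ _ _) hk, ?_⟩
    have hbM : σ 0 b ≤ M := by
      have : b = 0 ∨ b = 1 := by omega
      rcases this with rfl | rfl <;> assumption
    have := Nat.mul_le_mul_right (p.bound.eval M + 13) hbM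
    simp [bound, Expr.cost]
    omega

/-- The invariant rule for counting loops. -/
theorem run_loop {c b : ℕ} {p : Code} (hp : (loop c b p).WellFormed) {σ : Store}
    (Inv : ℕ → Store → Prop) (hset : ∀ i τ v, Inv i τ → Inv i (τ.set c 0 v)) (hinit : Inv 0 σ)
    (hstep : ∀ i < σ 0 b, ∀ τ : Store, (∀ a ∉ (loop c b p).writes, τ a = σ a) → τ c 0 = i →
      Inv i τ → Inv (i + 1) (p.run τ)) :
    Inv (σ 0 b) ((loop c b p).run σ) := by
  obtain ⟨hc, hb, hcp, h0p, hwf⟩ := hp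
  rw [run]
  have key : ∀ i ≤ σ 0 b, ∀ τ,
      (fun τ => (p.run τ).set c 0 (p.run τ c 0 + 1))^[i] (σ.set c 0 0) = τ →
      (∀ a ∉ (loop c b p).writes, τ a = σ a) ∧ τ c 0 = i ∧ Inv i τ := by
    intro i
    induction i with
    | zero =>
      rintro - τ rfl
      refine ⟨fun a ha => Store.set_of_ne ?_ _ _ _, ?_, hset _ _ _ hinit⟩
      · rintro rfl; simp [writes] at ha
      · exact (Store.set_same_eq_iff _ _ _ _ _).trans (if_pos rfl)
    | succ i ih =>
      rintro hi τ rfl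
      rw [Function.iterate_succ_apply']
      generalize hτ : (fun τ => (p.run τ).set c 0 (p.run τ c 0 + 1))^[i] (σ.set c 0 0) = τ
      obtain ⟨h1, h2, h3⟩ := ih (by omega) τ hτ
      refine ⟨fun a ha => ?_, ?_, hset _ _ _ (hstep i (by omega) τ h1 h2 h3)⟩
      · have ha' := ha
        simp only [writes, List.mem_cons, not_or] at ha'
        rw [Store.set_of_ne ha'.1, run_of_notMem_writes ha'.2, h1 a ha]
      · rw [Store.set_same_eq_iff, if_pos rfl, run_of_notMem_writes hcp, h2]
  exact (key _ le_rfl _ rfl).2.2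

end Code

end Loops

/-! ### The program for the terminal demands and its correctness -/

section Algorithm

open Code

/-- The `0`-th entry of an array, used as a variable. -/
def scalar (a : ℕ) : Expr := .get a (.lit 0)

/-- An entry of the array `0`. -/
def header (j : ℕ) : Expr := .get 0 (.lit j)

/-- An expression that vanishes if and only if the values of `x` and `y` agree. -/
def distinct (x y : Expr) : Expr := .add (.sub x y) (.sub y x)

theorem eval_distinct {x y : Expr} {σ : Store} :
    (distinct x y).eval σ = 0 ↔ x.eval σ = y.eval σ := by
  simp only [distinct, Expr.eval]; omega

/-- Mark the ends of the edge `g` (array `11`) in the array `7` if one of them is marked and `g` is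
neither of the edges `e`, `f` (arrays `8`, `9`). -/
def relaxEdge : Code :=
  .ite (distinct (scalar 11) (scalar 8))
    (.ite (distinct (scalar 11) (scalar 9))
      (.ite (.add (.get 7 (.get 1 (scalar 11))) (.get 7 (.get 2 (scalar 11))))
        (.seq (.put 7 (.get 1 (scalar 11)) (.lit 1)) (.put 7 (.get 2 (scalar 11)) (.lit 1)))
        .skip)
      .skip)
    .skip

/-- Mark in the array `7` the vertices that are joined to `u` when the edges `e`, `f` (arrays `8`,
`9`) are deleted. -/
def markReachable (u : Expr) : Code :=
  .seq (.loop 15 0 (.put 7 (scalar 15) (.lit 0)))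
    (.seq (.put 7 u (.lit 1)) (.loop 10 0 (.loop 11 1 relaxEdge)))

/-- Mark the terminals in the array `6`. -/
def markTerminals : Code :=
  .seq (.put 6 (header 2) (.lit 1)) (.seq (.put 6 (header 3) (.lit 1))
    (.loop 8 1 (.loop 9 1 (.seq (markReachable (header 2))
      (.ite (.get 7 (header 3)) .skip
        (.seq (.put 6 (.get 1 (scalar 8)) (.lit 1)) (.put 6 (.get 2 (scalar 8)) (.lit 1))))))))

/-- Decide whether `x` and `y` (arrays `12`, `13`) are in the same `3`-class; the result is the
variable `14`. -/
def testThreeClass : Code :=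
  .seq (.put 14 (.lit 0) (.lit 1))
    (.loop 8 1 (.loop 9 1 (.seq (markReachable (scalar 12))
      (.ite (.get 7 (scalar 13)) .skip (.put 14 (.lit 0) (.lit 0))))))

/-- Append the pair `x`, `y` to the output if it is a demand. -/
def emit : Code :=
  .ite (scalar 14) (.ite (distinct (scalar 12) (scalar 13)) (.ite (.get 6 (scalar 12))
    (.ite (.get 6 (scalar 13))
      (.seq (.put 4 (scalar 3) (scalar 12)) (.seq (.put 5 (scalar 3) (scalar 13))
        (.put 3 (.lit 0) (.add (scalar 3) (.lit 1)))))
      .skip) .skip) .skip) .skip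

/-- The program that computes the demands between terminals. -/
def demandsCode : Code :=
  .seq markTerminals (.loop 12 0 (.loop 13 0 (.seq testThreeClass emit)))

/-- The store `σ` holds the input `I`. -/
def HoldsInput (I : Input) (σ : Store) : Prop :=
  σ 0 = I.store 0 ∧ σ 1 = I.store 1 ∧ σ 2 = I.store 2

theorem HoldsInput.of_eq {I : Input} {σ τ : Store} (h : HoldsInput I σ) (h0 : τ 0 = σ 0)
    (h1 : τ 1 = σ 1) (h2 : τ 2 = σ 2) : HoldsInput I τ :=
  ⟨h0.trans h.1, h1.trans h.2.1, h2.trans h.2.2⟩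

theorem HoldsInput.n {I : Input} {σ : Store} (h : HoldsInput I σ) : σ 0 0 = I.n := by
  rw [h.1]; rfl

theorem HoldsInput.m {I : Input} {σ : Store} (h : HoldsInput I σ) : σ 0 1 = I.m := by
  rw [h.1]; rfl

theorem HoldsInput.s {I : Input} {σ : Store} (h : HoldsInput I σ) : σ 0 2 = I.s := by
  rw [h.1]; rfl

theorem HoldsInput.t {I : Input} {σ : Store} (h : HoldsInput I σ) : σ 0 3 = I.t := by
  rw [h.1]; rfl

theorem HoldsInput.src {I : Input} {σ : Store} (h : HoldsInput I σ) (e : Fin I.m) :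
    σ 1 e = I.src e := by
  rw [h.2.1]; simp [Input.store]

theorem HoldsInput.dst {I : Input} {σ : Store} (h : HoldsInput I σ) (e : Fin I.m) :
    σ 2 e = I.dst e := by
  rw [h.2.2]; simp [Input.store]

/-- There is a walk of length at most `r` from `u` to `v`. -/
def Within {V E : Type*} (G : Graph V E) (u : V) : ℕ → V → Prop
  | 0, v => v = u
  | r + 1, v => Within G u r v ∨ ∃ w, Within G u r w ∧ G.Adj w v

theorem Within.joined {V E : Type*} {G : Graph V E} {u v : V} {r : ℕ} (h : Within G u r v) :
    Joined G u v := by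
  induction r generalizing v with
  | zero => rw [Within] at h; subst h; exact .refl
  | succ r ih =>
    rcases h with h | ⟨w, hw, hwv⟩
    · exact ih h
    · exact (ih hw).tail hwv

theorem Within.mono {V E : Type*} {G : Graph V E} {u v : V} {r r' : ℕ} (h : Within G u r v)
    (hr : r ≤ r') : Within G u r' v := by
  induction r', hr using Nat.le_induction with
  | base => exact h
  | succ k _ ih => exact Or.inl ih

/-- A simple path has at most `n` vertices, so `n` rounds of relaxation suffice. -/
theorem within_card_iff {n : ℕ} {E : Type*} {G : Graph (Fin n) E} {u v : Fin n} :
    Within G u n v ↔ Joined G u v := by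
  refine ⟨Within.joined, fun h => ?_⟩
  obtain ⟨k, p, rfl, rfl, hadj, hinj⟩ := exists_injective_path h
  have hk : k ≤ n := by
    have := Fintype.card_le_of_injective (fun i : Fin (k + 1) => p i)
      (fun i j hij => Fin.ext (hinj i j (by omega) (by omega) hij))
    simp at this
    omega
  refine Within.mono ?_ hk
  have : ∀ i ≤ k, Within G (p 0) i (p i) := by
    intro i
    induction i with
    | zero => intro _; rfl
    | succ i ih => intro hi; exact Or.inr ⟨p i, ih (by omega), hadj i (by omega)⟩
  exact this k le_rfl

theorem run_relaxEdge {I : Input} {σ : Store} (hI : HoldsInput I σ) {e f g : Fin I.m}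
    (he : σ 8 0 = e) (hf : σ 9 0 = f) (hg : σ 11 0 = g) (v : Fin I.n) :
    relaxEdge.run σ 7 v ≠ 0 ↔ σ 7 v ≠ 0 ∨
      (g ≠ e ∧ g ≠ f ∧ (σ 7 (I.src g) ≠ 0 ∨ σ 7 (I.dst g) ≠ 0) ∧ (v = I.src g ∨ v = I.dst g)) := by
  have hset : σ.set 7 (I.src g) 1 11 = σ 11 := rfl
  have hset' : σ.set 7 (I.src g) 1 2 = σ 2 := rfl
  simp only [relaxEdge, run, eval_distinct, scalar, Expr.eval, hg, he, hf, Fin.val_inj,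
    Nat.add_eq_zero_iff, hI.src, hI.dst, hset, hset']
  split_ifs with h3 h4 h5
  · simp [h3]
  · simp [h4]
  · simp [h5]
  · simp only [Store.set_same_eq_iff, Fin.val_inj]
    split_ifs with h6 h7
    · simp only [h6, or_true, and_true]; tauto
    · simp only [h7, true_or, and_true]; tauto
    · simp [h6, h7]

/-- The expression `u` is evaluated only after the marks are cleared, so its value must not depend
on the arrays `7` and `15`. -/
theorem run_markReachable {I : Input} {σ : Store} (hI : HoldsInput I σ) {e f : Fin I.m}
    (he : σ 8 0 = e) (hf : σ 9 0 = f) {u : Expr} {a : Fin I.n}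
    (hu : ∀ τ : Store, (∀ b, b ≠ 7 → b ≠ 15 → τ b = σ b) → u.eval τ = a) (v : Fin I.n) :
    (markReachable u).run σ 7 v ≠ 0 ↔ Joined (I.graph.deleteEdges {e, f}) a v := by
  rw [markReachable, run, run]
  generalize hτ : (loop 15 0 (.put 7 (scalar 15) (.lit 0))).run σ = τ
  have hframe : ∀ b, b ≠ 7 → b ≠ 15 → τ b = σ b := fun b h1 h2 => by
    rw [← hτ]; exact run_of_notMem_writes (by simp [writes]; omega) σ
  have hzero : ∀ v : Fin I.n, τ 7 v = 0 := by
    have := run_loop (c := 15) (b := 0) (p := .put 7 (scalar 15) (.lit 0)) (σ := σ)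
      (by simp [WellFormed, writes])
      (fun i τ => ∀ v < i, τ 7 v = 0) (fun _ _ _ h => h) (by simp) (by
        intro i hi τ hτ hc h v hv
        simp only [run, scalar, Expr.eval, hc, Store.set_same_eq_iff]
        split_ifs with hvi
        · rfl
        · exact h v (by omega))
    rw [hτ, hI.n] at this
    exact fun v => this v v.2
  simp only [run, hu τ hframe, Expr.eval]
  generalize hυ : τ.set 7 a 1 = υ
  have hυ7 : ∀ v : Fin I.n, υ 7 v ≠ 0 ↔ v = a := by
    intro v
    simp only [← hυ, Store.set_same_eq_iff, hzero, Fin.val_inj]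
    split_ifs <;> simp_all
  have hυframe : ∀ b, b ≠ 7 → b ≠ 15 → υ b = σ b := fun b h1 h2 => by
    rw [← hυ, Store.set_of_ne h1, hframe b h1 h2]
  have hIυ : HoldsInput I υ := hI.of_eq (hυframe _ (by decide) (by decide))
    (hυframe _ (by decide) (by decide)) (hυframe _ (by decide) (by decide))
  set K := I.graph.deleteEdges {e, f} with hK
  have hwf : (loop 10 0 (loop 11 1 relaxEdge)).WellFormed := by
    simp [WellFormed, writes, relaxEdge]
  -- A mark can travel several edges in one round, so the marked set is only bracketed: it contains
  -- the vertices within distance `r` and is contained in the component of `a`.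
  have main := run_loop (σ := υ) hwf
    (fun r τ => (∀ v : Fin I.n, τ 7 v ≠ 0 → Joined K a v) ∧
      ∀ v : Fin I.n, Within K a r v → τ 7 v ≠ 0)
    (fun _ _ _ h => h)
    ⟨fun v hv => by rw [(hυ7 v).1 hv]; exact .refl, fun v hv => (hυ7 v).2 hv⟩ ?_
  · rw [hIυ.n] at main
    exact ⟨main.1 v, fun h => main.2 v (within_card_iff.2 h)⟩
  intro r hr ρ hρ hρc ⟨hρ1, hρ2⟩
  have hIρ : HoldsInput I ρ := hIυ.of_eq (hρ _ (by decide)) (hρ _ (by decide)) (hρ _ (by decide))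
  -- The third clause records that the edges scanned so far have passed on the marks of distance at
  -- most `r`.
  have inner := run_loop (σ := ρ) hwf.2.2.2.2
    (fun i τ => (∀ v : Fin I.n, τ 7 v ≠ 0 → Joined K a v) ∧
      (∀ v : Fin I.n, Within K a r v → τ 7 v ≠ 0) ∧
      ∀ (g : Fin I.m) (w v : Fin I.n), g.val < i → K.IsLink g w v → Within K a r w → τ 7 v ≠ 0)
    (fun _ _ _ h => h) ⟨hρ1, hρ2, fun g w v hg => absurd hg (by omega)⟩ ?_
  · refine ⟨inner.1, ?_⟩
    rintro v (hv | ⟨w, hw, g, hwv⟩)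
    · exact inner.2.1 v hv
    · exact inner.2.2 g w v (by rw [hIρ.m]; exact g.2) hwv hw
  intro i hi τ' hτ' hc ⟨h1, h2, h3⟩
  have hIτ : HoldsInput I τ' := hIρ.of_eq (hτ' _ (by decide)) (hτ' _ (by decide)) (hτ' _ (by decide))
  rw [hIρ.m] at hi
  have step := run_relaxEdge hIτ (e := e) (f := f) (g := ⟨i, hi⟩)
    (by rw [hτ' _ (by decide), hρ _ (by decide), hυframe _ (by decide) (by decide), he])
    (by rw [hτ' _ (by decide), hρ _ (by decide), hυframe _ (by decide) (by decide), hf]) hc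
  have hlink : ∀ (g : Fin I.m) w v, K.IsLink g w v ↔
      ((I.src g = w ∧ I.dst g = v) ∨ (I.src g = v ∧ I.dst g = w)) ∧ g ≠ e ∧ g ≠ f := by
    intro g w v
    rw [hK, Graph.deleteEdges_isLink]
    simp [Input.graph]
  refine ⟨?_, fun v hv => (step v).2 (Or.inl (h2 v hv)), ?_⟩
  · intro v hv
    rcases (step v).1 hv with hv | ⟨hge, hgf, hm, hv⟩
    · exact h1 v hv
    · have hadj : K.Adj (I.src ⟨i, hi⟩) (I.dst ⟨i, hi⟩) :=
        ⟨⟨i, hi⟩, (hlink _ _ _).2 ⟨Or.inl ⟨rfl, rfl⟩, hge, hgf⟩⟩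
      rcases hm with hm | hm <;> rcases hv with rfl | rfl
      · exact h1 _ hm
      · exact (h1 _ hm).tail hadj
      · exact (h1 _ hm).tail hadj.symm
      · exact h1 _ hm
  · intro g w v hg hl hw
    rw [step]
    rcases (show g.val ≤ i by omega).eq_or_lt with hgi | hgi
    · right
      obtain rfl : g = ⟨i, hi⟩ := Fin.ext hgi
      have hw' := h2 w hw
      obtain ⟨⟨rfl, rfl⟩ | ⟨rfl, rfl⟩, hge, hgf⟩ := (hlink _ _ _).1 hl
      · exact ⟨hge, hgf, Or.inl hw', Or.inr rfl⟩
      · exact ⟨hge, hgf, Or.inr hw', Or.inl rfl⟩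
    · exact Or.inl (h3 g w v hgi hl hw)

theorem Input.graph_inc_iff {I : Input} {e : Fin I.m} {v : Fin I.n} :
    I.graph.Inc e v ↔ v = I.src e ∨ v = I.dst e := by
  simp only [Graph.Inc, Input.graph]
  constructor
  · rintro ⟨w, ⟨rfl, -⟩ | ⟨-, rfl⟩⟩ <;> simp
  · rintro (rfl | rfl)
    · exact ⟨_, Or.inl ⟨rfl, rfl⟩⟩
    · exact ⟨_, Or.inr ⟨rfl, rfl⟩⟩

theorem run_markTerminals {I : Input} (hI : I.Valid) {σ : Store} (hσ : HoldsInput I σ)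
    (h6 : ∀ v : Fin I.n, σ 6 v = 0) (v : Fin I.n) :
    markTerminals.run σ 6 v ≠ 0 ↔ IsTerminal I.graph I.s I.t v := by
  rw [markTerminals, run, run]
  simp only [run, header, Expr.eval, hσ.s]
  rw [show σ.set 6 (I.s) 1 0 = σ 0 from rfl, hσ.t]
  generalize hτ : (σ.set 6 I.s 1).set 6 I.t 1 = τ
  have hIτ : HoldsInput I τ := hσ.of_eq (by rw [← hτ]; rfl) (by rw [← hτ]; rfl)
    (by rw [← hτ]; rfl)
  have hτ6 : ∀ v : Fin I.n, τ 6 v ≠ 0 ↔ v = I.s ∨ v = I.t := by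
    intro v
    simp only [← hτ, Store.set_same_eq_iff, h6, Fin.val_inj]
    split_ifs <;> simp_all
  have hwf : (loop 8 1 (loop 9 1 (.seq (markReachable (header 2)) (.ite (.get 7 (header 3)) .skip
        (.seq (.put 6 (.get 1 (scalar 8)) (.lit 1))
          (.put 6 (.get 2 (scalar 8)) (.lit 1))))))).WellFormed := by
    simp [WellFormed, writes, relaxEdge, markReachable]
  have main := run_loop (σ := τ) hwf
    (fun i ρ => ∀ v : Fin I.n, ρ 6 v ≠ 0 ↔ v = I.s ∨ v = I.t ∨
      ∃ e : Fin I.m, e.val < i ∧ e ∈ forced I.graph I.s I.t ∧ I.graph.Inc e v)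
    (fun _ _ _ h => h) (by simpa using hτ6) ?_
  · refine (main v).trans (or_congr_right (or_congr_right (exists_congr fun e => ?_)))
    rw [hIτ.m]
    simp only [e.2, true_and]
  intro i hi ρ hρ hρc hρ6
  have hIρ : HoldsInput I ρ := hIτ.of_eq (hρ _ (by decide)) (hρ _ (by decide)) (hρ _ (by decide))
  rw [hIτ.m] at hi
  -- The outer counter fixes `e`; its ends are marked once some `f` tried so far completes an
  -- `st`-cut with it.
  have inner := run_loop (σ := ρ) hwf.2.2.2.2
    (fun j υ => ∀ v : Fin I.n, υ 6 v ≠ 0 ↔ ρ 6 v ≠ 0 ∨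
      (∃ f : Fin I.m, f.val < j ∧ ¬ Joined (I.graph.deleteEdges {(⟨i, hi⟩ : Fin I.m), f}) I.s I.t) ∧
        (v = I.src ⟨i, hi⟩ ∨ v = I.dst ⟨i, hi⟩))
    (fun _ _ _ h => h) (by simp) ?_
  · intro v
    rw [inner v, hρ6 v, hIρ.m]
    have hf : (∃ f : Fin I.m, f.val < I.m ∧
        ¬ Joined (I.graph.deleteEdges {(⟨i, hi⟩ : Fin I.m), f}) I.s I.t) ↔
        (⟨i, hi⟩ : Fin I.m) ∈ forced I.graph I.s I.t := by
      rw [mem_forced_joined_iff hI.1 rfl]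
      exact exists_congr fun f => and_iff_right f.2
    rw [hf, ← Input.graph_inc_iff]
    constructor
    · rintro ((h | h | ⟨e, he, h⟩) | h)
      · exact Or.inl h
      · exact Or.inr (Or.inl h)
      · exact Or.inr (Or.inr ⟨e, by omega, h⟩)
      · exact Or.inr (Or.inr ⟨_, Nat.lt_succ_self i, h⟩)
    · rintro (h | h | ⟨e, he, h⟩)
      · exact Or.inl (Or.inl h)
      · exact Or.inl (Or.inr (Or.inl h))
      · rcases (show e.val ≤ i by omega).eq_or_lt with hei | hei
        · obtain rfl : e = ⟨i, hi⟩ := Fin.ext hei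
          exact Or.inr h
        · exact Or.inl (Or.inr (Or.inr ⟨e, hei, h⟩))
  intro j hj υ hυ hυc hυ6 v
  rw [hIρ.m] at hj
  have hIυ : HoldsInput I υ := hIρ.of_eq (hυ _ (by decide)) (hυ _ (by decide)) (hυ _ (by decide))
  rw [run]
  have hfr : ∀ a, a ∉ (markReachable (header 2)).writes →
      (markReachable (header 2)).run υ a = υ a := fun a ha => run_of_notMem_writes ha υ
  have hreach := run_markReachable hIυ (e := ⟨i, hi⟩) (f := ⟨j, hj⟩) (u := header 2) (a := I.s)
    (by rw [hυ _ (by decide), hρc]) hυc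
    (fun τ h => by simp only [header, Expr.eval]; rw [h 0 (by decide) (by decide), hIυ.s])
  generalize (markReachable (header 2)).run υ = ω at *
  have hIω : HoldsInput I ω := hIυ.of_eq (hfr _ (by decide)) (hfr _ (by decide))
    (hfr _ (by decide))
  have hω8 : ω 8 0 = i := by
    rw [hfr _ (by decide), hυ _ (by decide), hρc]
  have hsrc : ω 1 i = I.src ⟨i, hi⟩ := hIω.src ⟨i, hi⟩
  have hdst : ω 2 i = I.dst ⟨i, hi⟩ := hIω.dst ⟨i, hi⟩
  have hset : ω.set 6 (I.src ⟨i, hi⟩) 1 8 = ω 8 := rfl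
  have hset' : ω.set 6 (I.src ⟨i, hi⟩) 1 2 = ω 2 := rfl
  have hlt : ∀ f : Fin I.m, f.val < j + 1 ↔ f.val < j ∨ f = ⟨j, hj⟩ := by
    intro f; rw [Fin.ext_iff]; dsimp only; omega
  simp only [hlt, or_and_right, exists_or, exists_eq_left]
  rw [← or_assoc, ← hυ6 v, ← hreach I.t]
  have hω6 : ω 6 = υ 6 := hfr _ (by decide)
  have hc : (Expr.get 7 (header 3)).eval ω = ω 7 I.t := by simp only [header, Expr.eval, hIω.t]
  rw [run, hc]
  split_ifs with h
  · simp only [run, scalar, Expr.eval, hω8, hsrc, hdst, hset, hset']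
    simp only [Store.set_same_eq_iff, Fin.val_inj, hω6, h]
    split_ifs with h1 h2
    · simp [h1]
    · simp [h2]
    · simp [h1, h2]
  · simp [run, hω6, h]

theorem run_testThreeClass {I : Input} {σ : Store} (hσ : HoldsInput I σ) {x y : Fin I.n}
    (hx : σ 12 0 = x) (hy : σ 13 0 = y) :
    testThreeClass.run σ 14 0 ≠ 0 ↔ ∀ e f, Joined (I.graph.deleteEdges {e, f}) x y := by
  rw [testThreeClass, run]
  simp only [run, Expr.eval]
  generalize hτ : σ.set 14 0 1 = τ
  have hτf : ∀ a, a ≠ 14 → τ a = σ a := fun a ha => by rw [← hτ, Store.set_of_ne ha]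
  have hIτ : HoldsInput I τ := hσ.of_eq (hτf _ (by decide)) (hτf _ (by decide))
    (hτf _ (by decide))
  have hτ14 : τ 14 0 ≠ 0 := by rw [← hτ, Store.set_same_eq_iff]; simp
  have hwf : (loop 8 1 (loop 9 1 (.seq (markReachable (scalar 12))
      (.ite (.get 7 (scalar 13)) .skip (.put 14 (.lit 0) (.lit 0)))))).WellFormed := by
    simp [WellFormed, writes, relaxEdge, markReachable]
  have main := run_loop (σ := τ) hwf
    (fun i ρ => ρ 14 0 ≠ 0 ↔ ∀ e f : Fin I.m, e.val < i →
      Joined (I.graph.deleteEdges {e, f}) x y)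
    (fun _ _ _ h => h) (by simpa using hτ14) ?_
  · rw [hIτ.m] at main
    exact main.trans ⟨fun h e f => h e f e.2, fun h e f _ => h e f⟩
  intro i hi ρ hρ hρc hρ14
  have hIρ : HoldsInput I ρ := hIτ.of_eq (hρ _ (by decide)) (hρ _ (by decide)) (hρ _ (by decide))
  rw [hIτ.m] at hi
  have inner := run_loop (σ := ρ) hwf.2.2.2.2
    (fun j υ => υ 14 0 ≠ 0 ↔ ρ 14 0 ≠ 0 ∧ ∀ f : Fin I.m, f.val < j →
      Joined (I.graph.deleteEdges {(⟨i, hi⟩ : Fin I.m), f}) x y)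
    (fun _ _ _ h => h) (by simp) ?_
  · refine inner.trans ?_
    rw [hρ14, hIρ.m]
    constructor
    · rintro ⟨h1, h2⟩ e f he
      rcases (show e.val ≤ i by omega).eq_or_lt with hei | hei
      · obtain rfl : e = ⟨i, hi⟩ := Fin.ext hei
        exact h2 f f.2
      · exact h1 e f hei
    · exact fun h => ⟨fun e f he => h e f (by omega), fun f _ => h _ f (Nat.lt_succ_self i)⟩
  intro j hj υ hυ hυc hυ14
  rw [hIρ.m] at hj
  have hIυ : HoldsInput I υ := hIρ.of_eq (hυ _ (by decide)) (hυ _ (by decide)) (hυ _ (by decide))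
  rw [run]
  have hfr : ∀ a, a ∉ (markReachable (scalar 12)).writes →
      (markReachable (scalar 12)).run υ a = υ a := fun a ha => run_of_notMem_writes ha υ
  have hυ12 : υ 12 0 = x := by
    rw [hυ _ (by decide), hρ _ (by decide), hτf _ (by decide), hx]
  have hreach := run_markReachable hIυ (e := ⟨i, hi⟩) (f := ⟨j, hj⟩) (u := scalar 12) (a := x)
    (by rw [hυ _ (by decide), hρc]) hυc
    (fun τ h => by simp only [scalar, Expr.eval]; rw [h 12 (by decide) (by decide), hυ12])
  generalize (markReachable (scalar 12)).run υ = ω at *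
  have hω13 : ω 13 0 = y := by
    rw [hfr _ (by decide), hυ _ (by decide), hρ _ (by decide), hτf _ (by decide), hy]
  have hω14 : ω 14 = υ 14 := hfr _ (by decide)
  have hlt : ∀ f : Fin I.m, f.val < j + 1 ↔ f.val < j ∨ f = ⟨j, hj⟩ := by
    intro f; rw [Fin.ext_iff]; dsimp only; omega
  simp only [hlt, or_imp, forall_and, forall_eq]
  rw [← and_assoc, ← hυ14, ← hreach y]
  have hc : (Expr.get 7 (scalar 13)).eval ω = ω 7 y := by simp only [scalar, Expr.eval, hω13]
  rw [run, hc]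
  split_ifs with h
  · simp [run, Expr.eval, Store.set_same_eq_iff, h]
  · simp [run, hω14, h]

/-- The pair `u`, `v` is in the output list of the store `σ`. -/
def Listed (σ : Store) (u v : ℕ) : Prop := ∃ j < σ 3 0, σ 4 j = u ∧ σ 5 j = v

/-- The entries of the output list are below `n`. -/
def ListBounded (n : ℕ) (σ : Store) : Prop := ∀ j < σ 3 0, σ 4 j < n ∧ σ 5 j < n

theorem run_emit {n : ℕ} {σ : Store} {x y : Fin n} (hx : σ 12 0 = x) (hy : σ 13 0 = y)
    (h : ListBounded n σ) :
    ListBounded n (emit.run σ) ∧ ∀ u v : ℕ, Listed (emit.run σ) u v ↔ Listed σ u v ∨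
      ((σ 14 0 ≠ 0 ∧ x ≠ y ∧ σ 6 x ≠ 0 ∧ σ 6 y ≠ 0) ∧ u = x ∧ v = y) := by
  by_cases hc : σ 14 0 ≠ 0 ∧ x ≠ y ∧ σ 6 x ≠ 0 ∧ σ 6 y ≠ 0
  · obtain ⟨h1, h2, h3, h4⟩ := id hc
    have hrun : emit.run σ = ((σ.set 4 (σ 3 0) x).set 5 (σ 3 0) y).set 3 0 (σ 3 0 + 1) := by
      simp only [emit, run, eval_distinct, scalar, Expr.eval, hx, hy, Fin.val_inj, if_neg h1,
        if_neg h2, if_neg h3, if_neg h4]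
      simp [Store.set_of_ne, hy]
    have e3 : emit.run σ 3 0 = σ 3 0 + 1 := by rw [hrun, Store.set_same_eq_iff, if_pos rfl]
    have e4 : ∀ j, emit.run σ 4 j = if j = σ 3 0 then x.val else σ 4 j := by
      intro j; rw [hrun, Store.set_of_ne (by decide), Store.set_of_ne (by decide),
        Store.set_same_eq_iff]
    have e5 : ∀ j, emit.run σ 5 j = if j = σ 3 0 then y.val else σ 5 j := by
      intro j; rw [hrun, Store.set_of_ne (by decide), Store.set_same_eq_iff,
        Store.set_of_ne (by decide)]
    constructor
    · intro j hj
      rw [e4, e5]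
      split_ifs with hjl
      · exact ⟨x.2, y.2⟩
      · exact h j (by omega)
    · intro u v
      simp only [Listed, e3, e4, e5]
      constructor
      · rintro ⟨j, hj, hu, hv⟩
        split_ifs at hu hv with hjl
        · exact Or.inr ⟨hc, hu.symm, hv.symm⟩
        · exact Or.inl ⟨j, by omega, hu, hv⟩
      · rintro (⟨j, hj, hu, hv⟩ | ⟨-, rfl, rfl⟩)
        · exact ⟨j, by omega, by rw [if_neg (by omega), hu], by rw [if_neg (by omega), hv]⟩
        · exact ⟨σ 3 0, by omega, by simp, by simp⟩
  · have hrun : emit.run σ = σ := by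
      simp only [emit, run, eval_distinct, scalar, Expr.eval, hx, hy, Fin.val_inj]
      split_ifs <;> first | rfl | exact absurd ⟨‹_›, ‹_›, ‹_›, ‹_›⟩ hc
    rw [hrun]
    exact ⟨h, fun u v => by simp only [hc, false_and, or_false]⟩

theorem run_demandsCode {I : Input} (hI : I.Valid) :
    ListBounded I.n (demandsCode.run I.store) ∧ ∀ u v : Fin I.n,
      Listed (demandsCode.run I.store) u v ↔
        s(u, v) ∈ terminalDemands I.graph I.s I.t := by
  have hI0 : HoldsInput I I.store := ⟨rfl, rfl, rfl⟩
  have hfr : ∀ a, a ∉ markTerminals.writes → markTerminals.run I.store a = I.store a :=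
    fun a ha => run_of_notMem_writes ha _
  have hterm := run_markTerminals hI hI0 (fun v => rfl)
  rw [demandsCode, run]
  generalize markTerminals.run I.store = τ at *
  have hIτ : HoldsInput I τ := hI0.of_eq (hfr _ (by decide)) (hfr _ (by decide))
    (hfr _ (by decide))
  have hτ3 : τ 3 0 = 0 := by rw [hfr _ (by decide)]; rfl
  have hwf : (loop 12 0 (loop 13 0 (.seq testThreeClass emit))).WellFormed := by
    simp [WellFormed, writes, relaxEdge, markReachable, testThreeClass, emit]
  -- Each demand is listed in both orders, so the invariant speaks of ordered pairs with first entry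
  -- below `i`.
  have main := run_loop (σ := τ) hwf
    (fun i ρ => ListBounded I.n ρ ∧ ∀ u v : Fin I.n, Listed ρ u v ↔
      s(u, v) ∈ terminalDemands I.graph I.s I.t ∧ u.val < i)
    (fun _ _ _ h => h) (by simp [ListBounded, Listed, hτ3]) ?_
  · rw [hIτ.n] at main
    exact ⟨main.1, fun u v => by rw [main.2]; simp⟩
  intro i hi ρ hρ hρc ⟨hρb, hρl⟩
  have hIρ : HoldsInput I ρ := hIτ.of_eq (hρ _ (by decide)) (hρ _ (by decide)) (hρ _ (by decide))
  rw [hIτ.n] at hi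
  have inner := run_loop (σ := ρ) hwf.2.2.2.2
    (fun j υ => ListBounded I.n υ ∧ ∀ u v : Fin I.n, Listed υ u v ↔ Listed ρ u v ∨
      s(u, v) ∈ terminalDemands I.graph I.s I.t ∧ u = ⟨i, hi⟩ ∧ v.val < j)
    (fun _ _ _ h => h) ⟨hρb, by simp⟩ ?_
  · refine ⟨inner.1, fun u v => ?_⟩
    rw [inner.2, hρl, hIρ.n, Fin.ext_iff]
    have := v.2
    constructor
    · rintro (⟨h1, h2⟩ | ⟨h1, h2, -⟩)
      · exact ⟨h1, by omega⟩
      · exact ⟨h1, by dsimp only at h2; omega⟩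
    · rintro ⟨h1, h2⟩
      rcases (show u.val ≤ i by omega).eq_or_lt with h | h
      · exact Or.inr ⟨h1, h, v.2⟩
      · exact Or.inl ⟨h1, h⟩
  intro j hj υ hυ hυc ⟨hυb, hυl⟩
  rw [hIρ.n] at hj
  have hIυ : HoldsInput I υ := hIρ.of_eq (hυ _ (by decide)) (hυ _ (by decide)) (hυ _ (by decide))
  have hυ12 : υ 12 0 = (⟨i, hi⟩ : Fin I.n) := by rw [hυ _ (by decide), hρc]
  rw [run]
  have hfr' : ∀ a, a ∉ testThreeClass.writes → testThreeClass.run υ a = υ a :=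
    fun a ha => run_of_notMem_writes ha _
  have htest := run_testThreeClass hIυ (x := ⟨i, hi⟩) (y := ⟨j, hj⟩) hυ12 hυc
  rw [← threeClass_joined_iff hI.1 rfl] at htest
  generalize testThreeClass.run υ = ω at *
  have hω6 : ω 6 = τ 6 := by rw [hfr' _ (by decide), hυ _ (by decide), hρ _ (by decide)]
  have hbl : ListBounded I.n ω := by
    unfold ListBounded
    rw [hfr' 3 (by decide), hfr' 4 (by decide), hfr' 5 (by decide)]
    exact hυb
  have hll : ∀ u v, Listed ω u v ↔ Listed υ u v := by
    intro u v
    unfold Listed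
    rw [hfr' 3 (by decide), hfr' 4 (by decide), hfr' 5 (by decide)]
  obtain ⟨hb, hl⟩ := run_emit (x := ⟨i, hi⟩) (y := ⟨j, hj⟩)
    (by rw [hfr' _ (by decide), hυ12]) (by rw [hfr' _ (by decide), hυc]) hbl
  refine ⟨hb, fun u v => ?_⟩
  rw [hl, hll, hυl, htest, hω6, hterm, hterm, or_assoc]
  refine or_congr_right ?_
  constructor
  · rintro (⟨h1, h2, h3⟩ | ⟨⟨h1, h2, h3, h4⟩, h5, h6⟩)
    · exact ⟨h1, h2, by omega⟩
    · obtain rfl : u = ⟨i, hi⟩ := Fin.ext h5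
      obtain rfl : v = ⟨j, hj⟩ := Fin.ext h6
      exact ⟨mk_mem_terminalDemands.2 ⟨h3, h4, h2, h1⟩, rfl, Nat.lt_succ_self j⟩
  · rintro ⟨h1, rfl, h3⟩
    rcases (show v.val ≤ j by omega).eq_or_lt with h | h
    · obtain rfl : v = ⟨j, hj⟩ := Fin.ext h
      obtain ⟨a, b, c, d⟩ := mk_mem_terminalDemands.1 h1
      exact Or.inr ⟨⟨d, c, a, b⟩, rfl, rfl⟩
    · exact Or.inl ⟨h1, rfl, h⟩

theorem polynomiallyComputable_terminalDemands :
    PolynomiallyComputable fun I => terminalDemands I.graph I.s I.t := by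
  refine ⟨demandsCode.toProg, demandsCode.bound, fun I hI => ?_⟩
  have hwf : demandsCode.WellFormed := by
    simp [demandsCode, markTerminals, WellFormed, writes, relaxEdge, markReachable,
      testThreeClass, emit]
  obtain ⟨k, hk, hkM⟩ := exec_toProg hwf (M := I.n + I.m) (σ := I.store)
    (Nat.le_add_right _ _) (Nat.le_add_left _ _)
  obtain ⟨hb, hl⟩ := run_demandsCode hI
  refine ⟨_, k, hk, hkM, hb, fun u v => ?_⟩
  have h1 := hl u v
  have h2 := hl v u
  rw [Sym2.eq_swap] at h2
  constructor
  · intro h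
    obtain ⟨j, hj, h⟩ := h1.2 h
    exact ⟨j, hj, Or.inl h⟩
  · rintro ⟨j, hj, h | h⟩
    · exact h1.1 ⟨j, hj, h⟩
    · exact h2.1 ⟨j, hj, h⟩

end Algorithm
end RSND

theorem theorem3 :
    ∃ D : (I : RSND.Input) → Set (Sym2 (Fin I.n)),
      RSND.PolynomiallyComputable D ∧
      ∀ I : RSND.Input, I.Valid →
        (∀ u v : Fin I.n, s(u, v) ∈ D I → u ≠ v ∧ 3 ≤ RSND.edgeConn I.graph u v) ∧
        (∀ H : Set (Fin I.m), RSND.forced I.graph I.s I.t ⊆ H →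
          (RSND.Feasible I.graph I.s I.t H ↔
            ∀ u v : Fin I.n, s(u, v) ∈ D I → RSND.Satisfies I.graph H u v)) ∧
        (RSND.edgeConn I.graph I.s I.t < 3 →
          D I = RSND.cliqueDemands I.graph I.s I.t ∧
          ∀ T : (C : RSND.ThreeClass I.graph) →
              SimpleGraph (RSND.attachment I.graph I.s I.t C),
            (∀ C, RSND.Relevant I.graph I.s I.t C → (T C).IsTree) →
            ∀ H : Set (Fin I.m), RSND.forced I.graph I.s I.t ⊆ H →
              (RSND.Feasible I.graph I.s I.t H ↔
                ∀ u v : Fin I.n, s(u, v) ∈ RSND.graphDemands I.graph I.s I.t T →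
                  RSND.Satisfies I.graph H u v)) := by
  -- For `λ(s,t) ≥ 3` there are no forced edges and this set is just the pair `st`, whereas the
  -- clique set is empty; the two descriptions agree only when `λ(s,t) < 3`.
  refine ⟨fun I => RSND.terminalDemands I.graph I.s I.t,
    RSND.polynomiallyComputable_terminalDemands, fun I hI => ⟨fun u v h => ?_, fun H hH =>
      RSND.feasible_iff_terminalDemands hI.1 rfl hH, fun hst => ?_⟩⟩
  · obtain ⟨-, -, hne, h⟩ := RSND.mk_mem_terminalDemands.1 h
    exact ⟨hne, (RSND.three_le_edgeConn_iff hI.1 rfl).2 h⟩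
  · rw [← not_le, RSND.three_le_edgeConn_iff hI.1 rfl] at hst
    exact ⟨RSND.terminalDemands_eq_cliqueDemands hI.1 rfl hst, fun T hT H hH =>
      RSND.feasible_iff_graphDemands hI.1 rfl hst (fun C hC => (hT C hC).connected) hH⟩
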